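/- Let $K$ be a field with a valuation $\operatorname{val}:K^*\to\mathbb R$, value group $\Gamma$ (possibly trivial), residue field $\Bbbk$, and a splitting $\Gamma\to K^*$, $\gamma\mapsto t^\gamma$ (a group homomorphism with $\operatorname{val}(t^\gamma)=\gamma$). For $f=\sum_u c_ux^u\in K[x_1^{\pm1},\dots,x_n^{\pm1}]$ let $\operatorname{trop}(V(f))\subseteq\mathbb R^n$ be the non-linear locus of $w\mapsto\min_{c_u\ne 0}(\operatorname{val}(c_u)+w\cdot u)$, i.e. the set of points near which this function is not a real-valued affine function (so $\operatorname{trop}(V(0))=\mathbb R^n$). For an ideal $I\subseteq K[x_1^{\pm1},\dots,x_n^{\pm1}]$ let $V(I)\subseteq(\overline K^*)^n$ be its zero set, and let $\operatorname{trop}(V(I))=\bigcap_f\operatorname{trop}(V(f))$, the intersection over all $f\in K[x_1^{\pm1},\dots,x_n^{\pm1}]$ that vanish on $V(I)$. A finite tropical basis of $I$ is a finite set $\{f_1,\dots,f_r\}\subseteq I$ that generates $I$ and satisfies $\operatorname{trop}(V(I))=\bigcap_{i}\operatorname{trop}(V(f_i))$. For $f=\sum_u c_ux^u\in K[x_0,\dots,x_n]$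 and $w\in\mathbb R^{n+1}$ let $\operatorname{in}_w(f)=\sum\overline{t^{-\operatorname{val}(c_u)}c_u}\,x^u\in\Bbbk[x_0,\dots,x_n]$, the sum over the $u$ with $c_u\neq 0$ for which $\operatorname{val}(c_u)+w\cdot u$ is minimal. For an ideal $J\subseteq K[x_0,\dots,x_n]$ let $\operatorname{in}_w(J)=\langle\operatorname{in}_w(f):f\in J\rangle$ and $C_J[w]=\{w'\in\mathbb R^{n+1}:\operatorname{in}_{w'}(J)=\operatorname{in}_w(J)\}$. Let $I^h\subseteq K[x_0,\dots,x_n]$ be the ideal generated by the homogenizations $x_0^{\deg f}f(x_1/x_0,\dots,x_n/x_0)$ of all $f\in I\cap K[x_1,\dots,x_n]$; the sets $C_{I^h}[w]$ are the cells of its Gröbner complex. **Theorem.** Every ideal $I\subseteq K[x_1^{\pm1},\dots,x_n^{\pm1}]$ has a finite tropical basis. More precisely: 1. There are only finitely many cells $C_{I^h}[w]$, $w\in\mathbb R^{n+1}$. 2. If $\operatorname{in}_w(I^h)$ contains a monomial $x^u$, then there is $g\in I^h$ with $\operatorname{in}_{w'}(g)=x^u$ for all $w'\in C_{I^h}[w]$.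 3. Let $F$ be any finite generating set of $I$. For each cell $\sigma$ whose initial ideal contains a monomial, choose any $g_\sigma\in I^h$ whose initial form $\operatorname{in}_{w'}(g_\sigma)$ is one and the same monomial for all $w'\in\sigma$. Then $F\cup\{g_\sigma|_{x_0=1}\}_\sigma$ is a finite tropical basis of $I$. -/

import Mathlib

open scoped Topology

noncomputable section

namespace TropBasis

/-! ### Valued fields and splittings -/

/-- The valuation as a homomorphism `val : K^* → ℝ`. -/
def valHom {K : Type*} [Field K] (v : AddValuation K (WithTop ℝ)) : Additive Kˣ →+ ℝ where
  toFun a := (v (a.toMul : K)).untopD 0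
  map_zero' := by simp
  map_add' a b := by
    have ha : v (a.toMul : K) ≠ ⊤ := fun h => a.toMul.ne_zero (v.top_iff.1 h)
    have hb : v (b.toMul : K) ≠ ⊤ := fun h => b.toMul.ne_zero (v.top_iff.1 h)
    rw [toMul_add, Units.val_mul, v.map_mul]
    lift v (a.toMul : K) to ℝ using ha with x
    lift v (b.toMul : K) to ℝ using hb with y
    rw [← WithTop.coe_add]
    simp only [WithTop.untopD_coe]

/-- The value group `Γ ⊆ ℝ`, the image of the valuation. -/
def valueGroup {K : Type*} [Field K] (v : AddValuation K (WithTop ℝ)) : AddSubgroup ℝ :=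
  (valHom v).range

/-- The value `val(a)` of `a ∈ K^*`, as an element of `Γ`. -/
def valG {K : Type*} [Field K] (v : AddValuation K (WithTop ℝ)) (a : Kˣ) : valueGroup v :=
  (valHom v).rangeRestrict (Additive.ofMul a)

/-- A splitting of the valuation: a group homomorphism `Γ → K^*`, `γ ↦ t^γ`,
with `val(t^γ) = γ`. -/
structure Splitting {K : Type*} [Field K] (v : AddValuation K (WithTop ℝ)) where
  toHom : Multiplicative (valueGroup v) →* Kˣ
  val_toHom : ∀ γ : valueGroup v,
    v (toHom (Multiplicative.ofAdd γ) : K) = ((γ : ℝ) : WithTop ℝ)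

/-- The valuation ring `R = {a : val(a) ≥ 0}`. -/
abbrev valRing {K : Type*} [Field K] (v : AddValuation K (WithTop ℝ)) : ValuationSubring K :=
  (AddValuation.toValuation v).valuationSubring

/-- Membership in `R` is nonnegativity of the valuation. -/
theorem mem_valRing {K : Type*} [Field K] (v : AddValuation K (WithTop ℝ)) (a : K) :
    a ∈ valRing v ↔ 0 ≤ v a := Iff.rfl

/-- The residue field `𝕜 = R / 𝔪`. -/
abbrev ResField {K : Type*} [Field K] (v : AddValuation K (WithTop ℝ)) : Type _ :=
  IsLocalRing.ResidueField (valRing v)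

/-- For `c ≠ 0`, the element `t^{-val(c)} c` has valuation `0`, so lies in `R`. -/
theorem Splitting.normalize_mem {K : Type*} [Field K] {v : AddValuation K (WithTop ℝ)}
    (t : Splitting v) (c : Kˣ) :
    ((t.toHom (Multiplicative.ofAdd (-(valG v c))) : Kˣ) : K) * (c : K) ∈ valRing v := by
  rw [mem_valRing, v.map_mul, t.val_toHom]
  have hc : v (c : K) ≠ ⊤ := fun h => c.ne_zero (v.top_iff.1 h)
  have h1 : ((valG v c : valueGroup v) : ℝ) = (v (c : K)).untopD 0 := rfl
  rw [AddSubgroup.coe_neg, h1]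
  lift v (c : K) to ℝ using hc with x
  rw [WithTop.untopD_coe, ← WithTop.coe_add]
  simp

/-- The residue class of `t^{-val(c)} c` in `𝕜`, for `c ≠ 0` (and `0` for `c = 0`). -/
def Splitting.leadRes {K : Type*} [Field K] {v : AddValuation K (WithTop ℝ)}
    (t : Splitting v) (c : K) : ResField v :=
  open Classical in
  if h : c = 0 then 0
  else IsLocalRing.residue (valRing v) ⟨_, t.normalize_mem (Units.mk0 c h)⟩

/-! ### Laurent polynomials and tropical varieties -/

/-- The Laurent polynomial ring `K[x_1^{±1}, …, x_n^{±1}]`, the group algebra of `ℤ^n`. -/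
abbrev Laurent (n : ℕ) (K : Type*) [Field K] : Type _ := AddMonoidAlgebra K (Fin n → ℤ)

/-- The function `trop(f)(w) = min_u (val(c_u) + w ⬝ u)`, the minimum being over the support
of `f`. It is real-valued for `f ≠ 0`, and constantly `∞` for `f = 0`. -/
def trop {K : Type*} [Field K] (v : AddValuation K (WithTop ℝ)) {n : ℕ} (f : Laurent n K)
    (w : Fin n → ℝ) : WithTop ℝ :=
  f.coeff.support.inf fun u => v (f.coeff u) + ((∑ i, w i * (u i : ℝ) : ℝ) : WithTop ℝ)

/-- The tropical hypersurface `trop(V(f))`, the non-linear locus of `trop(f)`: the points near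
which `trop(f)` is not given by a single (real-valued) affine function. In particular
`trop(V(0))` is all of `ℝ^n`. -/
def tropHypersurface {K : Type*} [Field K] (v : AddValuation K (WithTop ℝ)) {n : ℕ}
    (f : Laurent n K) : Set (Fin n → ℝ) :=
  {w | ¬ ∃ (a : Fin n → ℝ) (b : ℝ),
    ∀ᶠ w' in 𝓝 w, trop v f w' = ((∑ i, a i * w' i + b : ℝ) : WithTop ℝ)}

/-- The points of the torus `T^n`, with coordinates in the algebraic closure of `K`
(which is `K` itself if `K` is algebraically closed). -/
abbrev Torus (n : ℕ) (K : Type*) [Field K] : Type _ := Fin n → (AlgebraicClosure K)ˣ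

/-- The character `u ↦ x^u = ∏ x_i^{u_i}` of `ℤ^n` at a point `x` of the torus. -/
def monomialAt {K : Type*} [Field K] {n : ℕ} (x : Torus n K) :
    Multiplicative (Fin n → ℤ) →* AlgebraicClosure K where
  toFun u := ((∏ i, x i ^ (u.toAdd i) : (AlgebraicClosure K)ˣ) : AlgebraicClosure K)
  map_one' := by simp
  map_mul' a b := by
    rw [← Units.val_mul, ← Finset.prod_mul_distrib]
    simp only [toAdd_mul, Pi.add_apply, zpow_add]

/-- Evaluation of Laurent polynomials at a point of the torus. -/
def evalAt {K : Type*} [Field K] {n : ℕ} (x : Torus n K) :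
    Laurent n K →ₐ[K] AlgebraicClosure K :=
  AddMonoidAlgebra.lift K (AlgebraicClosure K) (Fin n → ℤ) (monomialAt x)

/-- The subvariety `V(I)` of the torus. -/
def zeroSet {K : Type*} [Field K] {n : ℕ} (I : Ideal (Laurent n K)) : Set (Torus n K) :=
  {x | ∀ f ∈ I, evalAt x f = 0}

/-- The ideal `I(X)` of all Laurent polynomials over `K` that vanish on `X`. -/
def idealOf {K : Type*} [Field K] {n : ℕ} (X : Set (Torus n K)) : Ideal (Laurent n K) :=
  ⨅ x ∈ X, RingHom.ker (evalAt x)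

/-- The tropical variety `trop(X) = ⋂_{f ∈ I(X)} trop(V(f))`. -/
def tropVariety {K : Type*} [Field K] (v : AddValuation K (WithTop ℝ)) {n : ℕ}
    (X : Set (Torus n K)) : Set (Fin n → ℝ) :=
  ⋂ f ∈ idealOf X, tropHypersurface v f

/-- `B` is a finite tropical basis of `I`: a finite subset of `I` that generates `I` and
satisfies `trop(V(I)) = ⋂_{f ∈ B} trop(V(f))`. -/
structure IsFiniteTropicalBasis {K : Type*} [Field K] (v : AddValuation K (WithTop ℝ)) {n : ℕ}
    (I : Ideal (Laurent n K)) (B : Set (Laurent n K)) : Prop where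
  finite : B.Finite
  subset : B ⊆ (I : Set (Laurent n K))
  trop_eq : tropVariety v (zeroSet I) = ⋂ f ∈ B, tropHypersurface v f
  span_eq : Ideal.span B = I

/-! ### Initial ideals and the Gröbner complex -/

/-- The function `trop(f)` of a polynomial. -/
def tropPoly {K : Type*} [Field K] (v : AddValuation K (WithTop ℝ)) {m : ℕ}
    (f : MvPolynomial (Fin m) K) (w : Fin m → ℝ) : WithTop ℝ :=
  f.support.inf fun u => v (f.coeff u) + ((∑ i, w i * (u i : ℝ) : ℝ) : WithTop ℝ)

/-- The initial form `in_w(f)`: the sum of `\overline{t^{-val(c_u)} c_u} x^u` over the `u` in the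
support of `f` with `val(c_u) + w ⬝ u = trop(f)(w)`. This formula makes sense for every real
weight vector `w`. -/
def initialForm {K : Type*} [Field K] {v : AddValuation K (WithTop ℝ)} (t : Splitting v) {m : ℕ}
    (w : Fin m → ℝ) (f : MvPolynomial (Fin m) K) : MvPolynomial (Fin m) (ResField v) :=
  open Classical in
  ∑ u ∈ f.support with
      v (f.coeff u) + ((∑ i, w i * (u i : ℝ) : ℝ) : WithTop ℝ) = tropPoly v f w,
    MvPolynomial.monomial u (t.leadRes (f.coeff u))

/-- The initial ideal `in_w(J) = ⟨in_w(f) : f ∈ J⟩`. -/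
def initialIdeal {K : Type*} [Field K] {v : AddValuation K (WithTop ℝ)} (t : Splitting v) {m : ℕ}
    (w : Fin m → ℝ) (J : Ideal (MvPolynomial (Fin m) K)) :
    Ideal (MvPolynomial (Fin m) (ResField v)) :=
  Ideal.span (initialForm t w '' (J : Set (MvPolynomial (Fin m) K)))

/-- The cell `C_J[w]` of all weight vectors `w'` with `in_{w'}(J) = in_w(J)`; the polyhedra of the
Gröbner complex of a homogeneous ideal `J` are the closures of these sets. -/
def cell {K : Type*} [Field K] {v : AddValuation K (WithTop ℝ)} (t : Splitting v) {m : ℕ}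
    (J : Ideal (MvPolynomial (Fin m) K)) (w : Fin m → ℝ) : Set (Fin m → ℝ) :=
  {w' | initialIdeal t w' J = initialIdeal t w J}

/-- The cells `C_J[w]` of the Gröbner complex of `J`. -/
def cells {K : Type*} [Field K] {v : AddValuation K (WithTop ℝ)} (t : Splitting v) {m : ℕ}
    (J : Ideal (MvPolynomial (Fin m) K)) : Set (Set (Fin m → ℝ)) :=
  Set.range (cell t J)

/-- The cells `C_J[w]` for which `in_w(J)` contains a monomial. -/
def monomialCells {K : Type*} [Field K] {v : AddValuation K (WithTop ℝ)} (t : Splitting v) {m : ℕ}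
    (J : Ideal (MvPolynomial (Fin m) K)) : Set (Set (Fin m → ℝ)) :=
  {σ | ∃ w, σ = cell t J w ∧ ∃ u : Fin m →₀ ℕ, MvPolynomial.monomial u 1 ∈ initialIdeal t w J}

/-! ### Homogenization -/

/-- The variable `x_i` of the Laurent polynomial ring. -/
def laurentX {K : Type*} [Field K] {n : ℕ} (i : Fin n) : Laurent n K :=
  AddMonoidAlgebra.single (Pi.single i 1) 1

/-- The inclusion `K[x_1, …, x_n] → K[x_1^{±1}, …, x_n^{±1}]`. -/
def toLaurent {K : Type*} [Field K] {n : ℕ} : MvPolynomial (Fin n) K →ₐ[K] Laurent n K :=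
  MvPolynomial.aeval laurentX

/-- The homogenization `x_0^{deg f} f(x_1/x_0, …, x_n/x_0)` of `f`. -/
def homogenize {K : Type*} [Field K] {n : ℕ} (f : MvPolynomial (Fin n) K) :
    MvPolynomial (Fin (n + 1)) K :=
  ∑ u ∈ f.support,
    MvPolynomial.monomial (Finsupp.cons (f.totalDegree - u.degree) u) (f.coeff u)

/-- The homogeneous ideal `I^h`, generated by the homogenizations of all elements of
`I ∩ K[x_1, …, x_n]`. -/
def homogIdeal {K : Type*} [Field K] {n : ℕ} (I : Ideal (Laurent n K)) :
    Ideal (MvPolynomial (Fin (n + 1)) K) :=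
  Ideal.span {F | ∃ f : MvPolynomial (Fin n) K, toLaurent f ∈ I ∧ F = homogenize f}

/-- Setting `x_0 = 1`, as a map to the Laurent polynomial ring. -/
def dehomogenize {K : Type*} [Field K] {n : ℕ} :
    MvPolynomial (Fin (n + 1)) K →ₐ[K] Laurent n K :=
  MvPolynomial.aeval (Fin.cons 1 laurentX)

end TropBasis

end

noncomputable section

namespace TropBasis

/-! ### Leading residues of field elements. -/

section Valuation

variable {K : Type*} [Field K] {v : AddValuation K (WithTop ℝ)} (t : Splitting v)

/-! The Gröbner-theoretic part is linear algebra in one degree at a time. In degree `d` a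
homogeneous ideal is a subspace `L` of a finite coordinate space, and the degree `d` part of its
initial ideal is the span `in(L)` of the initial vectors of `L` (`degPart_initialIdeal`).
Independent initial vectors lift to independent vectors, and an initial vector is nonzero and
supported inside the support of its vector; hence `dim in(L) = dim L` (`finrank_vecInitSpace`).
Choose a set `C` of `dim L` coordinates that determines the elements of `in(L)`. It also determines
the elements of `L`, so for each `u` in `C` there is a unique `g` in `L` restricting to the unit
vector at `u` on `C`.

These reduced vectors depend on `C` alone, and their initial vectors span `in(L)`. So `in(L)` is
encoded by `C` and the sets where the minima are attained, which leaves finitely many possibilities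
(`finite_range_vecInitSpace`). If `in(L)` contains the unit vector at `u`, then `u` lies in `C`, and
the initial vector of the reduced `g` at `u` must be that unit vector for every weight with the same
initial space, as the difference lies in `in(L)` and vanishes on `C` (`exists_vecInit_eq_single`).
Finiteness in each degree, equality of Hilbert functions and the Noetherian property give finitely
many initial ideals (`finite_of_degPart`).

For the tropical basis, a point `w` lies off a hypersurface exactly when the minimum is attained by
one term (`notMem_tropHypersurface_iff`, `StrictMin`). If this happens for some `f` vanishing on
`V(I)`, a power of `f` lies in `I` by the Nullstellensatz. Clearing denominators and homogenizing
preserve the unique minimum, so the initial ideal of `I^h` at `(0, w)` contains a monomial. The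
witness for that cell then has a unique minimum at `(0, w)`, which survives `x_0 = 1`, so it
excludes `w`. -/

theorem val_ne_top {c : K} (hc : c ≠ 0) : v c ≠ ⊤ := fun h => hc (v.top_iff.1 h)

theorem exists_val_eq {c : K} (hc : c ≠ 0) : ∃ r : ℝ, v c = (r : WithTop ℝ) :=
  ⟨_, (WithTop.coe_untop _ (val_ne_top hc)).symm⟩

theorem coe_valG (c : Kˣ) : (((valG v c : valueGroup v) : ℝ) : WithTop ℝ) = v (c : K) := by
  obtain ⟨r, hr⟩ := exists_val_eq (v := v) c.ne_zero
  have h1 : ((valG v c : valueGroup v) : ℝ) = (v (c : K)).untopD 0 := rfl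
  rw [h1, hr, WithTop.untopD_coe]

theorem valG_mul (a b : Kˣ) : valG v (a * b) = valG v a + valG v b :=
  (valHom v).rangeRestrict.map_add (Additive.ofMul a) (Additive.ofMul b)

@[simp]
theorem leadRes_zero : t.leadRes 0 = 0 := by simp [Splitting.leadRes]

theorem leadRes_of_ne_zero {c : K} (h : c ≠ 0) :
    t.leadRes c = IsLocalRing.residue (valRing v) ⟨_, t.normalize_mem (Units.mk0 c h)⟩ := by
  rw [Splitting.leadRes, dif_neg h]

theorem residue_eq_zero_iff (a : valRing v) :
    IsLocalRing.residue (valRing v) a = 0 ↔ 0 < v (a : K) := by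
  rw [IsLocalRing.residue_eq_zero_iff, IsLocalRing.mem_maximalIdeal, mem_nonunits_iff]
  exact Valuation.Integer.not_isUnit_iff_valuation_lt_one (v := AddValuation.toValuation v)

/-- The leading residue of an element of value `γ` is the residue of its multiple by `t^{-γ}`. -/
theorem leadRes_eq_residue {c : K} {γ : valueGroup v} (hc : v c = ((γ : ℝ) : WithTop ℝ))
    (hm : ((t.toHom (Multiplicative.ofAdd (-γ)) : Kˣ) : K) * c ∈ valRing v) :
    t.leadRes c = IsLocalRing.residue (valRing v) ⟨_, hm⟩ := by
  have h0 : c ≠ 0 := by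
    rintro rfl
    simp at hc
  rw [leadRes_of_ne_zero t h0]
  have h : valG v (Units.mk0 c h0) = γ := by
    apply Subtype.ext
    have := coe_valG (v := v) (Units.mk0 c h0)
    rw [Units.val_mk0, hc] at this
    exact_mod_cast this
  subst h
  rfl

theorem val_scale_mul (γ : valueGroup v) (c : K) :
    v (((t.toHom (Multiplicative.ofAdd (-γ)) : Kˣ) : K) * c)
      = ((-(γ : ℝ) : ℝ) : WithTop ℝ) + v c := by
  rw [v.map_mul, t.val_toHom, AddSubgroup.coe_neg]

theorem leadRes_ne_zero {c : K} (h : c ≠ 0) : t.leadRes c ≠ 0 := by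
  rw [leadRes_of_ne_zero t h, Ne, residue_eq_zero_iff]
  have h1 := val_scale_mul t (valG v (Units.mk0 c h)) c
  have h2 := coe_valG (v := v) (Units.mk0 c h)
  rw [Units.val_mk0] at h2
  rw [← h2, ← WithTop.coe_add, neg_add_cancel] at h1
  exact fun h3 => (ne_of_gt h3) h1

theorem leadRes_one : t.leadRes 1 = 1 := by
  have h : ((t.toHom (Multiplicative.ofAdd (-(0 : valueGroup v))) : Kˣ) : K) * 1 = 1 := by simp
  have hm : ((t.toHom (Multiplicative.ofAdd (-(0 : valueGroup v))) : Kˣ) : K) * 1 ∈ valRing v := by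
    rw [h]; exact one_mem _
  rw [leadRes_eq_residue t (γ := 0) (by simp) hm, ← map_one (IsLocalRing.residue (valRing v))]
  congr 1
  exact Subtype.ext h

theorem leadRes_mul (a b : K) : t.leadRes (a * b) = t.leadRes a * t.leadRes b := by
  by_cases ha : a = 0
  · simp [ha]
  by_cases hb : b = 0
  · simp [hb]
  rw [leadRes_of_ne_zero t ha, leadRes_of_ne_zero t hb, leadRes_of_ne_zero t (mul_ne_zero ha hb),
    ← map_mul]
  congr 1
  apply Subtype.ext
  have h : Units.mk0 (a * b) (mul_ne_zero ha hb) = Units.mk0 a ha * Units.mk0 b hb := by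
    ext; simp
  simp only [h, valG_mul, neg_add, ofAdd_add, map_mul, Units.val_mul, MulMemClass.coe_mul]
  ring

/-- Leading residues of the terms of least value in a vanishing sum add up to zero. -/
theorem sum_leadRes_eq_zero {ι : Type*} (s : Finset ι) (x : ι → K) (γ : ℝ)
    (hx : ∀ i ∈ s, (γ : WithTop ℝ) ≤ v (x i)) (h0 : ∑ i ∈ s, x i = 0) :
    ∑ i ∈ s, (if v (x i) = (γ : WithTop ℝ) then t.leadRes (x i) else 0) = 0 := by
  -- For `γ` in the value group, multiply the relation by `t^{-γ}` and reduce modulo the maximal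
  -- ideal. Otherwise no term has value `γ` and every summand is zero.
  by_cases hγ : γ ∈ valueGroup v
  · set τ : K := ((t.toHom (Multiplicative.ofAdd (-(⟨γ, hγ⟩ : valueGroup v))) : Kˣ) : K) with hτ
    have hv : ∀ c, v (τ * c) = ((-γ : ℝ) : WithTop ℝ) + v c := fun c => val_scale_mul t ⟨γ, hγ⟩ c
    have hm : ∀ i ∈ s, τ * x i ∈ valRing v := by
      intro i hi
      rw [mem_valRing, hv]
      calc (0 : WithTop ℝ) = ((-γ : ℝ) : WithTop ℝ) + (γ : WithTop ℝ) := by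
            rw [← WithTop.coe_add]; simp
        _ ≤ _ := add_le_add_right (hx i hi) _
    have key : ∀ i : s, (if v (x i) = (γ : WithTop ℝ) then t.leadRes (x i) else 0)
        = IsLocalRing.residue (valRing v) ⟨τ * x i, hm i i.2⟩ := by
      intro i
      split_ifs with h
      · exact leadRes_eq_residue t (γ := ⟨γ, hγ⟩) h _
      · symm
        rw [residue_eq_zero_iff]
        have h1 : (γ : WithTop ℝ) < v (x i) := lt_of_le_of_ne (hx i i.2) (Ne.symm h)
        show 0 < v (τ * x i)
        rw [hv]
        cases h2 : v (x i) with
        | top => simp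
        | coe r =>
          rw [h2] at h1
          have h3 : γ < r := by exact_mod_cast h1
          rw [← WithTop.coe_add]
          have : (0 : ℝ) < -γ + r := by linarith
          exact_mod_cast this
    rw [← Finset.sum_coe_sort, Finset.sum_congr rfl fun i _ => key i, ← map_sum]
    rw [← map_zero (IsLocalRing.residue (valRing v))]
    congr 1
    apply Subtype.ext
    rw [AddSubmonoidClass.coe_finsetSum]
    simp only
    rw [← Finset.mul_sum, Finset.sum_coe_sort s x, h0, mul_zero]
    rfl
  · apply Finset.sum_eq_zero
    intro i _
    rw [if_neg]
    intro h
    have h1 : x i ≠ 0 := by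
      intro h2
      simp [h2] at h
    apply hγ
    have := coe_valG (v := v) (Units.mk0 _ h1)
    rw [Units.val_mk0, h, WithTop.coe_eq_coe] at this
    rw [← this]
    exact (valG v _).2

end Valuation

/-! ### Coordinates that determine a subspace. -/

section Linear

open Module

/-- A subspace of `M → F` is determined by as many coordinates as its dimension. -/
theorem exists_pivot_set {F M : Type*} [Field F] [Fintype M] (W : Submodule F (M → F)) :
    ∃ C : Finset M, C.card = finrank F W ∧ ∀ w ∈ W, (∀ u ∈ C, w u = 0) → w = 0 := by
  classical
  -- An independent family of coordinate functionals on `W` with full span still separates points.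
  -- Independence in the dual bounds its size above by `dim W`, separation bounds it below.
  let e : M → Dual F W := fun u => (LinearMap.proj u).comp W.subtype
  obtain ⟨κ, a, ha, hspan, hli⟩ := exists_linearIndependent' F e
  have : Fintype κ := Fintype.ofInjective a ha
  have hzero : ∀ w : W, (∀ i, e (a i) w = 0) → w = 0 := by
    intro w h
    have h1 : Submodule.span F (Set.range e) ≤ LinearMap.ker (Dual.eval F W w) := by
      rw [← hspan, Submodule.span_le]
      rintro _ ⟨i, rfl⟩
      exact h i
    apply Subtype.ext
    funext u
    exact h1 (Submodule.subset_span ⟨u, rfl⟩)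
  refine ⟨Finset.univ.image a, ?_, ?_⟩
  · rw [Finset.card_image_of_injective _ ha, Finset.card_univ]
    apply le_antisymm
    · rw [← Subspace.dual_finrank_eq]
      exact hli.fintype_card_le_finrank
    · have hinj : Function.Injective
          ((LinearMap.pi fun i : κ => e (a i)) : W →ₗ[F] (κ → F)) := by
        rw [injective_iff_map_eq_zero]
        intro w h
        exact hzero w fun i => congrFun h i
      simpa using LinearMap.finrank_le_finrank_of_injective hinj
  · intro w hw h
    have := hzero ⟨w, hw⟩ fun i => h (a i) (Finset.mem_image_of_mem _ (Finset.mem_univ i))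
    exact congrArg Subtype.val this

end Linear

/-! ### Initial subspaces of a finite-dimensional coordinate space. -/

section VectorInitial

open Module

variable {K : Type*} [Field K] {v : AddValuation K (WithTop ℝ)} (t : Splitting v)
  {M : Type*} [Fintype M]

theorem coe_sub_le_iff (a : WithTop ℝ) (m r : ℝ) :
    ((m - r : ℝ) : WithTop ℝ) ≤ a ↔ (m : WithTop ℝ) ≤ a + (r : WithTop ℝ) := by
  cases a with
  | top => simp
  | coe a =>
    rw [← WithTop.coe_add, WithTop.coe_le_coe, WithTop.coe_le_coe, sub_le_iff_le_add]

theorem eq_coe_sub_iff (a : WithTop ℝ) (m r : ℝ) :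
    a = ((m - r : ℝ) : WithTop ℝ) ↔ a + (r : WithTop ℝ) = (m : WithTop ℝ) := by
  cases a with
  | top => simpa using (WithTop.coe_ne_top (a := m - r)).symm
  | coe a => rw [← WithTop.coe_add, WithTop.coe_eq_coe, WithTop.coe_eq_coe, eq_sub_iff_add_eq]

/-- The minimum of `val(f_u) + ω_u` for a vector `f`. -/
def vecTrop (v : AddValuation K (WithTop ℝ)) (ω : M → ℝ) (f : M → K) : WithTop ℝ :=
  Finset.univ.inf fun u => v (f u) + (ω u : WithTop ℝ)

/-- The initial vector of `f` with respect to the weight `ω`. -/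
def vecInit (ω : M → ℝ) (f : M → K) : M → ResField v := fun u =>
  open Classical in
  if v (f u) + (ω u : WithTop ℝ) = vecTrop v ω f then t.leadRes (f u) else 0

/-- The initial subspace of `L` with respect to the weight `ω`. -/
def vecInitSpace (ω : M → ℝ) (L : Submodule K (M → K)) : Submodule (ResField v) (M → ResField v) :=
  Submodule.span _ (vecInit t ω '' L)

theorem vecTrop_le (ω : M → ℝ) (f : M → K) (u : M) :
    vecTrop v ω f ≤ v (f u) + (ω u : WithTop ℝ) :=
  Finset.inf_le (f := fun u => v (f u) + (ω u : WithTop ℝ)) (Finset.mem_univ u)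

theorem vecTrop_ne_top (ω : M → ℝ) {f : M → K} (hf : f ≠ 0) : vecTrop v ω f ≠ ⊤ := by
  obtain ⟨u, hu⟩ := Function.ne_iff.1 hf
  refine ne_top_of_le_ne_top ?_ (vecTrop_le ω f u)
  exact WithTop.add_ne_top.2 ⟨val_ne_top hu, WithTop.coe_ne_top⟩

theorem exists_eq_vecTrop (ω : M → ℝ) {f : M → K} (hf : f ≠ 0) :
    ∃ u, f u ≠ 0 ∧ v (f u) + (ω u : WithTop ℝ) = vecTrop v ω f := by
  obtain ⟨u, hu⟩ := Function.ne_iff.1 hf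
  obtain ⟨u', -, h⟩ := Finset.exists_mem_eq_inf Finset.univ ⟨u, Finset.mem_univ u⟩
    fun u => v (f u) + (ω u : WithTop ℝ)
  refine ⟨u', fun h0 => vecTrop_ne_top (v := v) ω hf ?_, h.symm⟩
  rw [vecTrop, h, h0]
  simp

theorem vecInit_ne_zero (ω : M → ℝ) {f : M → K} (hf : f ≠ 0) : vecInit t ω f ≠ 0 := by
  obtain ⟨u, h1, h2⟩ := exists_eq_vecTrop (v := v) ω hf
  refine Function.ne_iff.2 ⟨u, ?_⟩
  rw [vecInit, if_pos h2]
  exact leadRes_ne_zero t h1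

theorem vecInit_apply_of_eq_zero (ω : M → ℝ) {f : M → K} {u : M} (h : f u = 0) :
    vecInit t ω f u = 0 := by
  simp [vecInit, h]

@[simp]
theorem vecInit_zero (ω : M → ℝ) : vecInit t ω 0 = 0 :=
  funext fun _ => vecInit_apply_of_eq_zero t ω rfl

theorem vecInit_mem {ω : M → ℝ} {L : Submodule K (M → K)} {f : M → K} (hf : f ∈ L) :
    vecInit t ω f ∈ vecInitSpace t ω L :=
  Submodule.subset_span ⟨f, hf, rfl⟩

/-- Vectors with linearly independent initial vectors are linearly independent. -/
theorem linearIndependent_of_vecInit {ι : Type*} (ω : M → ℝ) (f : ι → M → K)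
    (h : LinearIndependent (ResField v) fun i => vecInit t ω (f i)) : LinearIndependent K f := by
  classical
  rw [linearIndependent_iff'] at h ⊢
  intro s g hg
  by_contra! hne
  obtain ⟨j, hj, hgj⟩ := hne
  have hf : f j ≠ 0 := by
    intro h0
    have := h {j} (fun _ => 1) (by simp [h0]) j (by simp)
    exact one_ne_zero this
  -- `T i` bounds the weighted values of all entries of `g i • f i` from below. Keeping only the
  -- terms of the relation at the overall minimum `m` yields a relation among the initial vectors,
  -- with leading residues as coefficients.
  let T : ι → WithTop ℝ := fun i => v (g i) + vecTrop v ω (f i)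
  obtain ⟨i₀, hi₀, hmin⟩ := Finset.exists_min_image s T ⟨j, hj⟩
  have htop : T i₀ ≠ ⊤ := ne_top_of_le_ne_top
    (WithTop.add_ne_top.2 ⟨val_ne_top hgj, vecTrop_ne_top ω hf⟩) (hmin j hj)
  obtain ⟨m, hm⟩ := WithTop.ne_top_iff_exists.1 htop
  let c : ι → ResField v := fun i => if T i = (m : WithTop ℝ) then t.leadRes (g i) else 0
  have hT : ∀ i u, T i ≤ v (g i * f i u) + (ω u : WithTop ℝ) := by
    intro i u
    rw [v.map_mul, add_assoc]
    exact add_le_add_right (vecTrop_le ω (f i) u) _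
  have hc : ∑ i ∈ s, c i • vecInit t ω (f i) = 0 := by
    funext u
    have h1 := sum_leadRes_eq_zero t s (fun i => g i * f i u) (m - ω u)
      (fun i hi => (coe_sub_le_iff _ _ _).2 (hm ▸ (hmin i hi).trans (hT i u)))
      (by simpa using congrFun hg u)
    rw [Finset.sum_apply, Pi.zero_apply, ← h1]
    refine Finset.sum_congr rfl fun i hi => ?_
    simp only [eq_coe_sub_iff, Pi.smul_apply, smul_eq_mul, c]
    by_cases hi' : T i = (m : WithTop ℝ)
    · rw [if_pos hi', vecInit]
      have hgi : v (g i) ≠ ⊤ := by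
        intro h2
        simp [T, h2] at hi'
      have h3 : v (g i * f i u) + (ω u : WithTop ℝ) = (m : WithTop ℝ)
          ↔ v (f i u) + (ω u : WithTop ℝ) = vecTrop v ω (f i) := by
        rw [← hi', v.map_mul, add_assoc]
        exact WithTop.add_left_inj hgi
      simp only [h3]
      split_ifs
      · rw [leadRes_mul]
      · rw [mul_zero]
    · rw [if_neg hi', zero_mul, if_neg]
      intro h2
      apply hi'
      exact le_antisymm (h2 ▸ hT i u) (hm ▸ hmin i hi)
  have := h s c hc i₀ hi₀
  simp only [c, if_pos hm.symm] at this
  refine leadRes_ne_zero t ?_ this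
  intro h0
  apply htop
  simp [T, h0]

/-- The initial space has a basis consisting of initial vectors, and their preimages in `L` are
independent by `linearIndependent_of_vecInit`. -/
theorem finrank_vecInitSpace_le (ω : M → ℝ) (L : Submodule K (M → K)) :
    finrank (ResField v) (vecInitSpace t ω L) ≤ finrank K L := by
  classical
  obtain ⟨b, hb, hspan, hli⟩ := exists_linearIndependent (ResField v) (vecInit t ω '' L)
  have : Fintype b := hli.setFinite.fintype
  choose f hf using fun x : b => hb x.2
  have hli' : LinearIndependent K f := by
    apply linearIndependent_of_vecInit t ω
    have : (fun i => vecInit t ω (f i)) = ((↑) : b → M → ResField v) := funext fun i => (hf i).2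
    rwa [this]
  rw [vecInitSpace, ← hspan, finrank_span_set_eq_card hli, Set.toFinset_card]
  have hli2 : LinearIndependent K (fun x : b => (⟨f x, (hf x).1⟩ : L)) :=
    LinearIndependent.of_comp L.subtype hli'
  exact hli2.fintype_card_le_finrank

/-- Restriction to a pivot set of the initial subspace of `L` is injective on `L`. -/
theorem eq_zero_of_pivot {ω : M → ℝ} {L : Submodule K (M → K)} {C : Finset M}
    (hC : ∀ w ∈ vecInitSpace t ω L, (∀ u ∈ C, w u = 0) → w = 0) {f : M → K} (hf : f ∈ L)
    (h : ∀ u ∈ C, f u = 0) : f = 0 := by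
  by_contra h0
  exact vecInit_ne_zero t ω h0
    (hC _ (vecInit_mem t hf) fun u hu => vecInit_apply_of_eq_zero t ω (h u hu))

/-- For the lower bound, a pivot set of the initial space also separates the elements of `L`. This
equality is what makes restriction to the pivot set bijective on `L`. -/
theorem finrank_vecInitSpace (ω : M → ℝ) (L : Submodule K (M → K)) :
    finrank (ResField v) (vecInitSpace t ω L) = finrank K L := by
  apply le_antisymm (finrank_vecInitSpace_le t ω L)
  obtain ⟨C, hcard, hC⟩ := exists_pivot_set (vecInitSpace t ω L)
  have hinj : Function.Injective
      ((LinearMap.pi fun u : C => (LinearMap.proj (u : M)).comp L.subtype) : L →ₗ[K] (C → K)) := by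
    rw [injective_iff_map_eq_zero]
    intro f h
    exact Subtype.ext (eq_zero_of_pivot t hC f.2 fun u hu => congrFun h ⟨u, hu⟩)
  rw [← hcard]
  simpa using LinearMap.finrank_le_finrank_of_injective hinj

/-- A pivot set of the initial subspace of `L`, of the right size, gives a reduced basis of `L`. -/
theorem exists_reduced {ω : M → ℝ} {L : Submodule K (M → K)} {C : Finset M}
    (hcard : C.card = finrank (ResField v) (vecInitSpace t ω L))
    (hC : ∀ w ∈ vecInitSpace t ω L, (∀ u ∈ C, w u = 0) → w = 0) {u : M} (hu : u ∈ C) :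
    ∃ g ∈ L, g u = 1 ∧ ∀ u' ∈ C, u' ≠ u → g u' = 0 := by
  classical
  let ρ : L →ₗ[K] (C → K) := LinearMap.pi fun u : C => (LinearMap.proj (u : M)).comp L.subtype
  have hinj : Function.Injective ρ := by
    rw [injective_iff_map_eq_zero]
    intro f h
    exact Subtype.ext (eq_zero_of_pivot t hC f.2 fun u hu => congrFun h ⟨u, hu⟩)
  have hsurj : Function.Surjective ρ :=
    (LinearMap.injective_iff_surjective_of_finrank_eq_finrank
      (by rw [finrank_vecInitSpace] at hcard; simp [hcard])).1 hinj
  obtain ⟨g, hg⟩ := hsurj (Pi.single ⟨u, hu⟩ 1)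
  refine ⟨g, g.2, ?_, ?_⟩
  · have := congrFun hg ⟨u, hu⟩
    rw [Pi.single_eq_same] at this
    exact this
  · intro u' hu' hne
    have := congrFun hg ⟨u', hu'⟩
    rw [Pi.single_eq_of_ne (by simpa using hne)] at this
    exact this

/-- The initial vector of a reduced vector restricts to a unit vector on the pivot set. -/
theorem vecInit_reduced {ω : M → ℝ} {L : Submodule K (M → K)} {C : Finset M}
    (hC : ∀ w ∈ vecInitSpace t ω L, (∀ u ∈ C, w u = 0) → w = 0) {u : M}
    {g : M → K} (hg : g ∈ L) (hg1 : g u = 1) (hg0 : ∀ u' ∈ C, u' ≠ u → g u' = 0) :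
    vecInit t ω g u = 1 := by
  have h1 : vecInit t ω g u ≠ 0 := by
    intro h
    have hg' : g ≠ 0 := by
      rintro rfl
      simp at hg1
    refine vecInit_ne_zero t ω hg' (hC _ (vecInit_mem t hg) fun u' hu' => ?_)
    by_cases hne : u' = u
    · rw [hne, h]
    · exact vecInit_apply_of_eq_zero t ω (hg0 u' hu' hne)
  rw [vecInit] at h1 ⊢
  split_ifs at h1 ⊢
  · rw [hg1, leadRes_one]
  · exact absurd rfl h1

/-- A unit vector in an initial subspace of `L` is the initial vector of one and the same element of
`L` for all weights with that initial subspace. -/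
theorem exists_vecInit_eq_single [DecidableEq M] (ω : M → ℝ) (L : Submodule K (M → K)) (u : M)
    (hu : Pi.single u 1 ∈ vecInitSpace t ω L) :
    ∃ g ∈ L, ∀ ω', vecInitSpace t ω' L = vecInitSpace t ω L → vecInit t ω' g = Pi.single u 1 := by
  obtain ⟨C, hcard, hC⟩ := exists_pivot_set (vecInitSpace t ω L)
  have huC : u ∈ C := by
    by_contra h
    have h1 := hC _ hu fun u' hu' => Pi.single_eq_of_ne (by rintro rfl; exact h hu') _
    have := congrFun h1 u
    simp at this
  obtain ⟨g, hgL, hg1, hg0⟩ := exists_reduced t hcard hC huC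
  -- The choice of `g` involves only `C`, and `C` is equally a pivot set for every `ω'` with the
  -- same initial space.
  refine ⟨g, hgL, fun ω' hω' => ?_⟩
  rw [← sub_eq_zero]
  apply hC
  · exact sub_mem (hω' ▸ vecInit_mem t hgL) hu
  · intro u' hu'
    by_cases hne : u' = u
    · subst hne
      rw [Pi.sub_apply, vecInit_reduced t (L := L) (hω' ▸ hC) hgL hg1 hg0]
      simp
    · rw [Pi.sub_apply, vecInit_apply_of_eq_zero t ω' (hg0 u' hu' hne), Pi.single_eq_of_ne hne,
        sub_zero]

/-- A subspace has only finitely many initial subspaces. -/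
theorem finite_range_vecInitSpace (L : Submodule K (M → K)) :
    (Set.range fun ω : M → ℝ => vecInitSpace t ω L).Finite := by
  classical
  -- The reduced family is fixed for each `C` before any weight is given; where none exists the
  -- value `0` is a dummy.
  have hG : ∀ C : Finset M, ∃ G : M → M → K,
      (∃ G : M → M → K, ∀ u ∈ C, G u ∈ L ∧ G u u = 1 ∧ ∀ u' ∈ C, u' ≠ u → G u u' = 0) →
      ∀ u ∈ C, G u ∈ L ∧ G u u = 1 ∧ ∀ u' ∈ C, u' ≠ u → G u u' = 0 := by
    intro C
    by_cases h : ∃ G : M → M → K, ∀ u ∈ C, G u ∈ L ∧ G u u = 1 ∧ ∀ u' ∈ C, u' ≠ u → G u u' = 0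
    · obtain ⟨G, hG⟩ := h
      exact ⟨G, fun _ => hG⟩
    · exact ⟨0, fun h' => absurd h' h⟩
  choose G hG using hG
  -- The second component of `p` records, for each pivot `u`, the coordinates at which the reduced
  -- vector attains its minimum. Only finitely many such pairs exist.
  let Φ : Finset M × (M → Finset M) → Submodule (ResField v) (M → ResField v) := fun p =>
    Submodule.span _ ((fun u u' => if u' ∈ p.2 u then t.leadRes (G p.1 u u') else 0) '' p.1)
  refine (Set.finite_range Φ).subset ?_
  rintro _ ⟨ω, rfl⟩
  obtain ⟨C, hcard, hC⟩ := exists_pivot_set (vecInitSpace t ω L)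
  have hGC := hG C (by
    choose! g hg using fun u (hu : u ∈ C) => exists_reduced t hcard hC hu
    exact ⟨g, fun u hu => hg u hu⟩)
  refine ⟨(C, fun u => {u' | v (G C u u') + (ω u' : WithTop ℝ) = vecTrop v ω (G C u)}), ?_⟩
  have hΦ : (fun u u' => if u' ∈ ({u' | v (G C u u') + (ω u' : WithTop ℝ) =
      vecTrop v ω (G C u)} : Finset M) then t.leadRes (G C u u') else 0)
      = fun u => vecInit t ω (G C u) := by
    funext u u'
    simp [vecInit]
  simp only [Φ, hΦ]
  apply le_antisymm
  · rw [Submodule.span_le]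
    rintro _ ⟨u, hu, rfl⟩
    exact vecInit_mem t (hGC u hu).1
  · intro w hw
    have h1 : ∑ u ∈ C, w u • vecInit t ω (G C u) ∈
        Submodule.span (ResField v) ((fun u => vecInit t ω (G C u)) '' C) :=
      Submodule.sum_mem _ fun u hu => Submodule.smul_mem _ _ (Submodule.subset_span ⟨u, hu, rfl⟩)
    have h2 : ∑ u ∈ C, w u • vecInit t ω (G C u) ∈ vecInitSpace t ω L :=
      Submodule.sum_mem _ fun u hu => Submodule.smul_mem _ _ (vecInit_mem t (hGC u hu).1)
    -- On `C` the initial vectors of the reduced family are unit vectors, so the entries of `w` on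
    -- `C` are its coefficients.
    have h3 : w - ∑ u ∈ C, w u • vecInit t ω (G C u) = 0 := by
      refine hC _ (sub_mem hw h2) fun u hu => ?_
      rw [Pi.sub_apply, Finset.sum_apply, Finset.sum_eq_single u, Pi.smul_apply,
        vecInit_reduced t hC (hGC u hu).1 (hGC u hu).2.1 (hGC u hu).2.2]
      · simp
      · intro u' hu' hne
        rw [Pi.smul_apply, vecInit_apply_of_eq_zero t ω ((hGC u' hu').2.2 u hu hne.symm), smul_zero]
      · exact fun h => absurd hu h
    rw [sub_eq_zero.1 h3]
    exact h1

end VectorInitial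

/-! ### Minima attained by a single term, and monomial initial forms. -/

section StrictMin

variable {K : Type*} [Field K] {v : AddValuation K (WithTop ℝ)}

/-- The minimum of `val(c_u) + φ(u)` is finite and attained exactly at `a`. -/
def StrictMin (v : AddValuation K (WithTop ℝ)) {A : Type*} (c : A → K) (φ : A → ℝ) (a : A) : Prop :=
  c a ≠ 0 ∧ ∀ u, u ≠ a → v (c a) + (φ a : WithTop ℝ) < v (c u) + (φ u : WithTop ℝ)

theorem StrictMin.le {A : Type*} {c : A → K} {φ : A → ℝ} {a : A} (h : StrictMin v c φ a) (u : A) :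
    v (c a) + (φ a : WithTop ℝ) ≤ v (c u) + (φ u : WithTop ℝ) := by
  by_cases hu : u = a
  · rw [hu]
  · exact (h.2 u hu).le

/-- The coefficients of an initial form. -/
theorem coeff_initialForm (t : Splitting v) {m : ℕ} (w : Fin m → ℝ) (f : MvPolynomial (Fin m) K)
    (u : Fin m →₀ ℕ) :
    (initialForm t w f).coeff u =
      open Classical in
      if v (f.coeff u) + ((∑ i, w i * (u i : ℝ) : ℝ) : WithTop ℝ) = tropPoly v f w
      then t.leadRes (f.coeff u) else 0 := by
  classical
  rw [initialForm, MvPolynomial.coeff_sum]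
  simp only [MvPolynomial.coeff_monomial]
  rw [Finset.sum_ite_eq']
  simp only [Finset.mem_filter, MvPolynomial.mem_support_iff]
  by_cases h : f.coeff u = 0
  · simp [h]
  · simp [h]

theorem tropPoly_le {m : ℕ} (w : Fin m → ℝ) (f : MvPolynomial (Fin m) K) (u : Fin m →₀ ℕ) :
    tropPoly v f w ≤ v (f.coeff u) + ((∑ i, w i * (u i : ℝ) : ℝ) : WithTop ℝ) := by
  by_cases h : f.coeff u = 0
  · simp [h]
  · exact Finset.inf_le
      (f := fun u => v (f.coeff u) + ((∑ i, w i * (u i : ℝ) : ℝ) : WithTop ℝ))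
      (MvPolynomial.mem_support_iff.2 h)

theorem exists_eq_tropPoly {m : ℕ} (w : Fin m → ℝ) {f : MvPolynomial (Fin m) K} (hf : f ≠ 0) :
    ∃ u, f.coeff u ≠ 0 ∧
      v (f.coeff u) + ((∑ i, w i * (u i : ℝ) : ℝ) : WithTop ℝ) = tropPoly v f w := by
  obtain ⟨u, hu, h⟩ := Finset.exists_mem_eq_inf f.support
    (MvPolynomial.support_nonempty.2 hf)
    fun u => v (f.coeff u) + ((∑ i, w i * (u i : ℝ) : ℝ) : WithTop ℝ)
  exact ⟨u, MvPolynomial.mem_support_iff.1 hu, h.symm⟩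

/-- Leading residues of nonzero coefficients are nonzero, so a second minimizing term would be
visible in the initial form. -/
theorem strictMin_of_initialForm_eq (t : Splitting v) {m : ℕ} {w : Fin m → ℝ}
    {f : MvPolynomial (Fin m) K} {u : Fin m →₀ ℕ}
    (h : initialForm t w f = MvPolynomial.monomial u 1) :
    StrictMin v (fun u => f.coeff u) (fun u => ∑ i, w i * (u i : ℝ)) u := by
  classical
  have hc := fun u' => (coeff_initialForm t w f u').symm.trans (congrArg (MvPolynomial.coeff u') h)
  simp only [MvPolynomial.coeff_monomial] at hc
  have hu := hc u
  rw [if_pos rfl] at hu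
  have h1 : v (f.coeff u) + ((∑ i, w i * (u i : ℝ) : ℝ) : WithTop ℝ) = tropPoly v f w := by
    by_contra h1
    rw [if_neg h1] at hu
    exact zero_ne_one hu
  have h0 : f.coeff u ≠ 0 := by
    intro h0
    simp [h0] at hu
  refine ⟨h0, fun u' hne => ?_⟩
  simp only [h1]
  by_cases h2 : f.coeff u' = 0
  · rw [h2, v.map_zero, top_add, ← h1]
    exact WithTop.lt_top_iff_ne_top.2 (WithTop.add_ne_top.2 ⟨val_ne_top h0, WithTop.coe_ne_top⟩)
  · refine lt_of_le_of_ne (tropPoly_le w f u') fun h3 => ?_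
    have h4 := hc u'
    rw [if_pos h3.symm, if_neg hne.symm] at h4
    exact leadRes_ne_zero t h2 h4

theorem StrictMin.initialForm_eq (t : Splitting v) {m : ℕ} {w : Fin m → ℝ}
    {f : MvPolynomial (Fin m) K} {u : Fin m →₀ ℕ}
    (h : StrictMin v (fun u => f.coeff u) (fun u => ∑ i, w i * (u i : ℝ)) u) :
    initialForm t w f = MvPolynomial.monomial u (t.leadRes (f.coeff u)) := by
  classical
  have hf : f ≠ 0 := by
    rintro rfl
    exact h.1 (MvPolynomial.coeff_zero _)
  obtain ⟨u', hu', hmin⟩ := exists_eq_tropPoly (v := v) w hf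
  have huu : u' = u := by
    by_contra hne
    exact absurd (tropPoly_le (v := v) w f u) (not_le.2 (hmin ▸ h.2 u' hne))
  subst huu
  ext u
  rw [coeff_initialForm, MvPolynomial.coeff_monomial]
  by_cases hne : u' = u
  · subst hne
    rw [if_pos hmin, if_pos rfl]
  · rw [if_neg hne, if_neg]
    intro h1
    have := h.2 u (Ne.symm hne)
    simp only [h1, hmin] at this
    exact lt_irrefl _ this

end StrictMin

/-! ### Tropical hypersurfaces and products. -/

section Hypersurface

variable {K : Type*} [Field K] {v : AddValuation K (WithTop ℝ)} {n : ℕ}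

theorem trop_le (f : Laurent n K) (w : Fin n → ℝ) (u : Fin n → ℤ) :
    trop v f w ≤ v (f.coeff u) + ((∑ i, w i * (u i : ℝ) : ℝ) : WithTop ℝ) := by
  by_cases h : f.coeff u = 0
  · simp [h]
  · exact Finset.inf_le
      (f := fun u => v (f.coeff u) + ((∑ i, w i * (u i : ℝ) : ℝ) : WithTop ℝ))
      (Finsupp.mem_support_iff.2 h)

/-- A linear form that is nonnegative near a point vanishes. -/
theorem eq_zero_of_eventually_nonneg (w d : Fin n → ℝ)
    (h : ∀ᶠ w' in 𝓝 w, 0 ≤ ∑ i, d i * (w' i - w i)) : d = 0 := by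
  -- Moving from `w` against `d` makes the linear form equal to `-ε |d|²`.
  have h1 : Filter.Tendsto (fun ε : ℝ => w - ε • d) (𝓝[>] 0) (𝓝 w) := by
    have : Continuous fun ε : ℝ => w - ε • d := by fun_prop
    have h2 := this.tendsto 0
    simp only [zero_smul, sub_zero] at h2
    exact h2.mono_left nhdsWithin_le_nhds
  obtain ⟨ε, h2, hε⟩ := ((h1.eventually h).and self_mem_nhdsWithin).exists
  have hε : 0 < ε := hε
  have h3 : ∑ i, d i * ((w - ε • d) i - w i) = -(ε * ∑ i, d i * d i) := by
    rw [Finset.mul_sum, ← Finset.sum_neg_distrib]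
    refine Finset.sum_congr rfl fun i _ => ?_
    simp only [Pi.sub_apply, Pi.smul_apply, smul_eq_mul]
    ring
  rw [h3] at h2
  have h4 : ∑ i, d i * d i = 0 := by
    apply le_antisymm
    · nlinarith
    · exact Finset.sum_nonneg fun i _ => mul_self_nonneg _
  rw [Finset.sum_eq_zero_iff_of_nonneg fun i _ => mul_self_nonneg _] at h4
  funext i
  exact mul_self_eq_zero.1 (h4 i (Finset.mem_univ i))

/-- The points off the tropical hypersurface are those where the minimum is attained once. -/
theorem notMem_tropHypersurface_iff (f : Laurent n K) (w : Fin n → ℝ) :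
    w ∉ tropHypersurface v f ↔
      ∃ a, StrictMin v (fun u => f.coeff u) (fun u => ∑ i, w i * (u i : ℝ)) a := by
  rw [tropHypersurface, Set.mem_ofPred_eq, not_not]
  constructor
  · rintro ⟨a, b, h⟩
    have hw := h.self_of_nhds
    -- A minimizing term is an affine function lying above the affine function `trop(f)` near `w`
    -- and meeting it at `w`, so the slopes agree. This determines the exponent.
    have hmin : ∀ u, v (f.coeff u) + ((∑ i, w i * (u i : ℝ) : ℝ) : WithTop ℝ) = trop v f w →
        f.coeff u ≠ 0 ∧ ∀ i, (u i : ℝ) = a i := by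
      intro u hu
      have h0 : f.coeff u ≠ 0 := by
        intro h0
        rw [h0, v.map_zero, top_add, hw] at hu
        exact WithTop.coe_ne_top hu.symm
      refine ⟨h0, ?_⟩
      obtain ⟨r, hr⟩ := exists_val_eq (v := v) h0
      have h1 := eq_zero_of_eventually_nonneg w (fun i => (u i : ℝ) - a i) (by
        filter_upwards [h] with w' hw'
        have h2 := trop_le (v := v) f w' u
        rw [hw', hr, ← WithTop.coe_add, WithTop.coe_le_coe] at h2
        rw [hw, hr, ← WithTop.coe_add, WithTop.coe_eq_coe] at hu
        have h3 : ∑ i, ((u i : ℝ) - a i) * (w' i - w i)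
            = (∑ i, w' i * (u i : ℝ) - ∑ i, w i * (u i : ℝ))
              - (∑ i, a i * w' i - ∑ i, a i * w i) := by
          simp only [← Finset.sum_sub_distrib]
          exact Finset.sum_congr rfl fun i _ => by ring
        rw [h3]
        linarith)
      intro i
      have := congrFun h1 i
      simpa [sub_eq_zero] using this
    have hne : f.coeff.support.Nonempty := by
      by_contra h0
      rw [Finset.not_nonempty_iff_eq_empty] at h0
      rw [trop, h0, Finset.inf_empty] at hw
      exact WithTop.coe_ne_top hw.symm
    obtain ⟨u, hu, hinf⟩ := Finset.exists_mem_eq_inf f.coeff.support hne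
      fun u => v (f.coeff u) + ((∑ i, w i * (u i : ℝ) : ℝ) : WithTop ℝ)
    have hinf : trop v f w = v (f.coeff u) + ((∑ i, w i * (u i : ℝ) : ℝ) : WithTop ℝ) := hinf
    refine ⟨u, Finsupp.mem_support_iff.1 hu, fun u' hne => ?_⟩
    simp only [← hinf]
    refine lt_of_le_of_ne (trop_le f w u') fun h1 => hne ?_
    funext i
    have h2 := (hmin u' h1.symm).2 i
    have h3 := (hmin u hinf.symm).2 i
    exact_mod_cast h2.trans h3.symm
  · rintro ⟨a, h0, h⟩
    obtain ⟨r, hr⟩ := exists_val_eq (v := v) h0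
    refine ⟨fun i => (a i : ℝ), r, ?_⟩
    -- Each strict inequality at `w` persists nearby by continuity, and the support is finite.
    have h1 : ∀ᶠ w' in 𝓝 w, ∀ u ∈ f.coeff.support,
        v (f.coeff a) + ((∑ i, w' i * (a i : ℝ) : ℝ) : WithTop ℝ)
          ≤ v (f.coeff u) + ((∑ i, w' i * (u i : ℝ) : ℝ) : WithTop ℝ) := by
      rw [Filter.eventually_all_finset]
      intro u hu
      by_cases hua : u = a
      · subst hua
        exact Filter.Eventually.of_forall fun _ => le_rfl
      · obtain ⟨s, hs⟩ := exists_val_eq (v := v) (Finsupp.mem_support_iff.1 hu)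
        have h2 := h u hua
        simp only [hr, hs, ← WithTop.coe_add, WithTop.coe_lt_coe] at h2
        have hc : ∀ u : Fin n → ℤ, ∀ r : ℝ,
            Continuous fun w' : Fin n → ℝ => r + ∑ i, w' i * (u i : ℝ) := by
          intro u r
          fun_prop
        filter_upwards [((hc a r).continuousAt (x := w)).eventually_lt
          ((hc u s).continuousAt (x := w)) h2] with w' hw'
        rw [hr, hs, ← WithTop.coe_add, ← WithTop.coe_add, WithTop.coe_le_coe]
        exact hw'.le
    filter_upwards [h1] with w' hw'
    have h2 : trop v f w' = v (f.coeff a) + ((∑ i, w' i * (a i : ℝ) : ℝ) : WithTop ℝ) :=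
      le_antisymm (trop_le f w' a) (Finset.le_inf hw')
    rw [h2, hr, ← WithTop.coe_add, add_comm]
    simp only [mul_comm]

/-- Strict minima add under multiplication. -/
theorem StrictMin.mul {f g : Laurent n K} {φ : (Fin n → ℤ) →+ ℝ} {a b : Fin n → ℤ}
    (hf : StrictMin v (fun u => f.coeff u) φ a) (hg : StrictMin v (fun u => g.coeff u) φ b) :
    StrictMin v (fun u => (f * g).coeff u) φ (a + b) := by
  classical
  obtain ⟨r, hr⟩ := exists_val_eq (v := v) hf.1
  obtain ⟨s, hs⟩ := exists_val_eq (v := v) hg.1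
  -- The bound is the value that a coefficient at exponent `i + j` needs in order to tie with the
  -- leading term. For `i + j = a + b` it equals `r + s`, so the term of `(a, b)` cannot be
  -- cancelled.
  have hlt : ∀ i j, (i, j) ≠ (a, b) →
      ((r + s + φ (a + b) - φ (i + j) : ℝ) : WithTop ℝ) < v (f.coeff i * g.coeff j) := by
    intro i j hij
    have h1 := hf.le i
    have h2 := hg.le j
    by_cases hi0 : f.coeff i = 0
    · simp only [hi0, zero_mul, v.map_zero]
      exact WithTop.coe_lt_top _
    by_cases hj0 : g.coeff j = 0
    · simp only [hj0, mul_zero, v.map_zero]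
      exact WithTop.coe_lt_top _
    obtain ⟨r', hr'⟩ := exists_val_eq (v := v) hi0
    obtain ⟨s', hs'⟩ := exists_val_eq (v := v) hj0
    rw [v.map_mul, hr', hs', ← WithTop.coe_add, WithTop.coe_lt_coe, map_add, map_add]
    simp only [hr, hs, hr', hs', ← WithTop.coe_add, WithTop.coe_le_coe] at h1 h2
    by_cases hi : i = a
    · have hj : j ≠ b := fun hj => hij (by rw [hi, hj])
      have h3 := hg.2 j hj
      simp only [hs, hs', ← WithTop.coe_add, WithTop.coe_lt_coe] at h3
      linarith
    · have h3 := hf.2 i hi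
      simp only [hr, hr', ← WithTop.coe_add, WithTop.coe_lt_coe] at h3
      linarith
  let P : Finset ((Fin n → ℤ) × (Fin n → ℤ)) := f.coeff.support ×ˢ g.coeff.support
  have hcoeff : ∀ c, (f * g).coeff c
      = ∑ p ∈ P with p.1 + p.2 = c, f.coeff p.1 * g.coeff p.2 := by
    intro c
    rw [AddMonoidAlgebra.coeff_mul, Finsupp.sum, Finset.sum_filter, Finset.sum_product]
    rfl
  have hab : v ((f * g).coeff (a + b)) = ((r + s : ℝ) : WithTop ℝ) := by
    rw [hcoeff, ← Finset.add_sum_erase _ _ (a := (a, b))]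
    · rw [v.map_add_eq_of_lt_left]
      · rw [v.map_mul, hr, hs, WithTop.coe_add]
      · rw [v.map_mul, hr, hs, ← WithTop.coe_add]
        refine v.map_lt_sum WithTop.coe_ne_top fun p hp => ?_
        rw [Finset.mem_erase, Finset.mem_filter] at hp
        have := hlt p.1 p.2 hp.1
        rw [hp.2.2] at this
        simpa using this
    · simpa [P] using ⟨hf.1, hg.1⟩
  refine ⟨fun h0 => ?_, fun c hc => ?_⟩
  · simp only [h0, v.map_zero] at hab
    exact WithTop.coe_ne_top hab.symm
  · simp only [hab, ← WithTop.coe_add]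
    have h1 : ((r + s + φ (a + b) - φ c : ℝ) : WithTop ℝ) < v ((f * g).coeff c) := by
      rw [hcoeff]
      refine v.map_lt_sum WithTop.coe_ne_top fun p hp => ?_
      rw [Finset.mem_filter] at hp
      have := hlt p.1 p.2 fun h => hc (by
        rw [← hp.2, (Prod.mk.inj h).1, (Prod.mk.inj h).2])
      rwa [hp.2] at this
    cases h2 : v ((f * g).coeff c) with
    | top => simp
    | coe q =>
      rw [h2, WithTop.coe_lt_coe] at h1
      rw [← WithTop.coe_add, WithTop.coe_lt_coe]
      linarith

/-- The weight of Laurent monomials, as an additive map. -/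
def weightHom (w : Fin n → ℝ) : (Fin n → ℤ) →+ ℝ where
  toFun u := ∑ i, w i * (u i : ℝ)
  map_zero' := by simp
  map_add' a b := by simp [mul_add, Finset.sum_add_distrib]

theorem strictMin_single (φ : (Fin n → ℤ) → ℝ) (a : Fin n → ℤ) {c : K} (hc : c ≠ 0) :
    StrictMin v (fun u => (AddMonoidAlgebra.single a c : Laurent n K).coeff u) φ a := by
  refine ⟨by simpa using hc, fun u hu => ?_⟩
  have h1 : (AddMonoidAlgebra.single a c : Laurent n K).coeff u = 0 := by
    simp [Finsupp.single_eq_of_ne hu]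
  simp only [h1, v.map_zero, top_add]
  exact WithTop.lt_top_iff_ne_top.2
    (WithTop.add_ne_top.2 ⟨val_ne_top (by simpa using hc), WithTop.coe_ne_top⟩)

theorem StrictMin.pow {f : Laurent n K} {φ : (Fin n → ℤ) →+ ℝ} {a : Fin n → ℤ}
    (hf : StrictMin v (fun u => f.coeff u) φ a) (k : ℕ) :
    StrictMin v (fun u => (f ^ k).coeff u) φ (k • a) := by
  induction k with
  | zero =>
    rw [pow_zero, zero_smul]
    exact strictMin_single φ 0 one_ne_zero
  | succ k ih =>
    rw [pow_succ, succ_nsmul]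
    exact ih.mul hf

end Hypersurface

/-! ### Strict minima under maps of exponents. -/

section Pushforward

variable {K : Type*} [Field K] {v : AddValuation K (WithTop ℝ)}

/-- A strict minimum persists when exponents of equal weight are collapsed. -/
theorem StrictMin.mapDomain {A B : Type*} {c : A →₀ K} {φ : A → ℝ} {a : A}
    (h : StrictMin v c φ a) (e : A → B) {ψ : B → ℝ} (hφ : ∀ u, ψ (e u) = φ u) :
    StrictMin v (c.mapDomain e) ψ (e a) := by
  classical
  obtain ⟨r, hr⟩ := exists_val_eq (v := v) h.1
  have hcoeff : ∀ b, c.mapDomain e b = ∑ u ∈ c.support with e u = b, c u := by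
    intro b
    rw [Finsupp.mapDomain, Finsupp.sum_apply, Finsupp.sum, Finset.sum_filter]
    simp only [Finsupp.single_apply]
  have hlt : ∀ u, u ≠ a → ((r + φ a - φ u : ℝ) : WithTop ℝ) < v (c u) := by
    intro u hu
    have h1 := h.2 u hu
    rw [hr] at h1
    cases h2 : v (c u) with
    | top => exact WithTop.coe_lt_top _
    | coe s =>
      rw [h2, ← WithTop.coe_add, ← WithTop.coe_add, WithTop.coe_lt_coe] at h1
      rw [WithTop.coe_lt_coe]
      linarith
  have ha : v (c.mapDomain e (e a)) = (r : WithTop ℝ) := by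
    rw [hcoeff, ← Finset.add_sum_erase _ _ (a := a)]
    · rw [v.map_add_eq_of_lt_left, hr]
      rw [hr]
      refine v.map_lt_sum WithTop.coe_ne_top fun u hu => ?_
      rw [Finset.mem_erase, Finset.mem_filter] at hu
      -- Exponents in the fibre of `e a` have the weight of `a`, so the bound on their values
      -- reduces to `r` and `c a` dominates the fibre sum.
      have h1 := hlt u hu.1
      rw [← hφ a, ← hφ u, hu.2.2] at h1
      simpa using h1
    · simpa using h.1
  refine ⟨fun h0 => ?_, fun b hb => ?_⟩
  · rw [h0, v.map_zero] at ha
    exact WithTop.coe_ne_top ha.symm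
  · have h1 : ((r + ψ (e a) - ψ b : ℝ) : WithTop ℝ) < v (c.mapDomain e b) := by
      rw [hcoeff]
      refine v.map_lt_sum WithTop.coe_ne_top fun u hu => ?_
      rw [Finset.mem_filter] at hu
      have h1 := hlt u fun h => hb (by rw [← hu.2, h])
      rwa [← hφ a, ← hφ u, hu.2] at h1
    rw [ha]
    cases h2 : v (c.mapDomain e b) with
    | top =>
      rw [top_add, ← WithTop.coe_add]
      exact WithTop.coe_lt_top _
    | coe q =>
      rw [h2, WithTop.coe_lt_coe] at h1
      rw [← WithTop.coe_add, ← WithTop.coe_add, WithTop.coe_lt_coe]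
      linarith

theorem StrictMin.of_mapDomain {A B : Type*} {c : A →₀ K} {e : A → B} (he : Function.Injective e)
    {ψ : B → ℝ} {b : B} (h : StrictMin v (c.mapDomain e) ψ b) :
    ∃ a, StrictMin v c (fun u => ψ (e u)) a := by
  have hb : b ∈ Set.range e := by
    by_contra hb
    exact h.1 (Finsupp.mapDomain_of_notMem_range _ _ hb)
  obtain ⟨a, rfl⟩ := hb
  refine ⟨a, ?_, fun u hu => ?_⟩
  · have := h.1
    rwa [Finsupp.mapDomain_apply he] at this
  · have := h.2 (e u) (he.ne hu)
    rwa [Finsupp.mapDomain_apply he, Finsupp.mapDomain_apply he] at this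

end Pushforward

/-! ### Homogenization and dehomogenization on exponents. -/

section Exponents

variable {K : Type*} [Field K] {n : ℕ}

/-- The inclusion `ℕ^n → ℤ^n` of exponents. -/
def castExp : (Fin n →₀ ℕ) →+ (Fin n → ℤ) where
  toFun u i := u i
  map_zero' := by ext; simp
  map_add' a b := by ext; simp

/-- Exponents after setting `x_0 = 1`. -/
def tailExp : (Fin (n + 1) →₀ ℕ) →+ (Fin n → ℤ) where
  toFun u i := u i.succ
  map_zero' := by ext; simp
  map_add' a b := by ext; simp

theorem castExp_injective : Function.Injective (castExp (n := n)) := by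
  intro a b h
  ext i
  have := congrFun h i
  simpa [castExp] using this

/-- Viewing the change of rings as a pushforward of exponents lets the results on
`Finsupp.mapDomain` transport strict minima. -/
theorem toLaurent_eq : (toLaurent : MvPolynomial (Fin n) K →ₐ[K] Laurent n K)
    = AddMonoidAlgebra.mapDomainAlgHom K K castExp := by
  apply MvPolynomial.algHom_ext
  intro i
  rw [toLaurent, MvPolynomial.aeval_X]
  simp only [laurentX, MvPolynomial.X, ← MvPolynomial.single_eq_monomial,
    AddMonoidAlgebra.mapDomainAlgHom_apply, AddMonoidAlgebra.mapDomain_single]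
  congr 1
  ext j
  simp [castExp, Finsupp.single_apply, Pi.single_apply, eq_comm]

theorem dehomogenize_eq : (dehomogenize : MvPolynomial (Fin (n + 1)) K →ₐ[K] Laurent n K)
    = AddMonoidAlgebra.mapDomainAlgHom K K tailExp := by
  apply MvPolynomial.algHom_ext
  intro i
  rw [dehomogenize, MvPolynomial.aeval_X]
  simp only [MvPolynomial.X, ← MvPolynomial.single_eq_monomial,
    AddMonoidAlgebra.mapDomainAlgHom_apply, AddMonoidAlgebra.mapDomain_single]
  refine Fin.cases ?_ (fun i => ?_) i
  · rw [Fin.cons_zero, AddMonoidAlgebra.one_def]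
    congr 1
    ext j
    simp [tailExp]
  · rw [Fin.cons_succ, laurentX]
    congr 1
    ext j
    simp [tailExp, Finsupp.single_apply, Pi.single_apply, eq_comm]

theorem coeff_toLaurent (p : MvPolynomial (Fin n) K) :
    (toLaurent p).coeff = Finsupp.mapDomain castExp (AddMonoidAlgebra.coeff p) := by
  rw [toLaurent_eq]
  rfl

theorem coeff_dehomogenize (F : MvPolynomial (Fin (n + 1)) K) :
    (dehomogenize F).coeff = Finsupp.mapDomain tailExp (AddMonoidAlgebra.coeff F) := by
  rw [dehomogenize_eq]
  rfl

theorem coeff_homogenize (p : MvPolynomial (Fin n) K) :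
    AddMonoidAlgebra.coeff (homogenize p) =
      Finsupp.mapDomain (fun u => Finsupp.cons (p.totalDegree - u.degree) u)
        (AddMonoidAlgebra.coeff p) := by
  rw [homogenize, AddMonoidAlgebra.coeff_sum]
  rfl

theorem dehomogenize_homogenize (p : MvPolynomial (Fin n) K) :
    dehomogenize (homogenize p) = toLaurent p := by
  apply AddMonoidAlgebra.coeff_injective
  rw [coeff_dehomogenize, coeff_homogenize, coeff_toLaurent, ← Finsupp.mapDomain_comp]
  congr 1

theorem dehomogenize_mem {I : Ideal (Laurent n K)} {F : MvPolynomial (Fin (n + 1)) K}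
    (hF : F ∈ homogIdeal I) : dehomogenize F ∈ I := by
  have : homogIdeal I ≤ I.comap (dehomogenize (K := K) (n := n)) := by
    rw [homogIdeal, Ideal.span_le]
    rintro _ ⟨f, hf, rfl⟩
    show dehomogenize (homogenize f) ∈ I
    rwa [dehomogenize_homogenize]
  exact this hF

/-- Denominators of Laurent polynomials can be cleared. -/
theorem exists_monomial_mul_eq_toLaurent (f : Laurent n K) :
    ∃ (a : Fin n →₀ ℕ) (p : MvPolynomial (Fin n) K),
      toLaurent (MvPolynomial.monomial a 1) * f = toLaurent p := by
  induction f using AddMonoidAlgebra.induction_linear with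
  | zero => exact ⟨0, 0, by simp⟩
  | add f g hf hg =>
    obtain ⟨a, p, hp⟩ := hf
    obtain ⟨b, q, hq⟩ := hg
    refine ⟨a + b, MvPolynomial.monomial b 1 * p + MvPolynomial.monomial a 1 * q, ?_⟩
    rw [map_add, map_mul, map_mul, ← hp, ← hq, ← one_mul (1 : K), ← MvPolynomial.monomial_mul,
      map_mul, one_mul]
    ring
  | single m c =>
    -- The negative parts of the exponents form the denominator and the positive parts remain.
    refine ⟨Finsupp.equivFunOnFinite.symm fun i => (-(m i)).toNat,
      MvPolynomial.monomial (Finsupp.equivFunOnFinite.symm fun i => (m i).toNat) c, ?_⟩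
    simp only [toLaurent_eq, ← MvPolynomial.single_eq_monomial,
      AddMonoidAlgebra.mapDomainAlgHom_apply, AddMonoidAlgebra.mapDomain_single,
      AddMonoidAlgebra.single_mul_single, one_mul]
    congr 1
    ext i
    simp only [castExp, AddMonoidHom.coe_mk, ZeroHom.coe_mk, Pi.add_apply,
      Finsupp.equivFunOnFinite_symm_apply_apply]
    omega

end Exponents

/-! ### The Nullstellensatz on the torus. -/

section Nullstellensatz

variable {K : Type*} [Field K] {n : ℕ}

instance isNoetherianRing_laurent : IsNoetherianRing (Laurent n K) :=
  Algebra.FiniteType.isNoetherianRing K _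

instance isJacobsonRing_laurent : IsJacobsonRing (Laurent n K) :=
  isJacobsonRing_of_finiteType (A := K)

/-- Every `K`-algebra homomorphism to the algebraic closure is evaluation at a torus point. -/
theorem exists_evalAt_eq (ψ : Laurent n K →ₐ[K] AlgebraicClosure K) :
    ∃ x : Torus n K, evalAt x = ψ := by
  let θ : Multiplicative (Fin n → ℤ) →* (AlgebraicClosure K)ˣ :=
    ((ψ : Laurent n K →* AlgebraicClosure K).comp
      (AddMonoidAlgebra.of K (Fin n → ℤ))).toHomUnits
  refine ⟨fun i => θ (Multiplicative.ofAdd (Pi.single i 1)), ?_⟩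
  apply AddMonoidAlgebra.algHom_ext
  swap
  · exact Subsingleton.elim _ _
  intro a
  rw [evalAt, AddMonoidAlgebra.lift_single, one_smul]
  have h1 : ∏ i, θ (Multiplicative.ofAdd (Pi.single i 1)) ^ (a i) = θ (Multiplicative.ofAdd a) := by
    simp only [← map_zpow, ← map_prod, ← ofAdd_zsmul, ← ofAdd_sum]
    congr 2
    ext j
    simp [Finset.sum_apply, Pi.single_apply]
  exact congrArg Units.val h1

/-- The Nullstellensatz for the torus. -/
theorem exists_pow_mem_of_mem_idealOf {I : Ideal (Laurent n K)} {f : Laurent n K}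
    (hf : f ∈ idealOf (zeroSet I)) : ∃ k, f ^ k ∈ I := by
  have h : f ∈ I.radical := by
    rw [Ideal.radical_eq_jacobson, Ideal.jacobson, Ideal.mem_sInf]
    rintro M ⟨hIM, hM⟩
    let _ : Field (Laurent n K ⧸ M) := Ideal.Quotient.field M
    -- The residue field is finite over `K`, hence embeds in the algebraic closure. The embedding is
    -- a torus point of `V(I)`; `f` vanishes there, so `f` lies in `M`.
    have : Module.Finite K (Laurent n K ⧸ M) := finite_of_finite_type_of_isJacobsonRing _ _
    let ι : (Laurent n K ⧸ M) →ₐ[K] AlgebraicClosure K := IsAlgClosed.lift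
    obtain ⟨x, hx⟩ := exists_evalAt_eq (ι.comp (Ideal.Quotient.mkₐ K M))
    have hxI : x ∈ zeroSet I := by
      intro g hg
      rw [hx]
      simp [Ideal.Quotient.eq_zero_iff_mem.2 (hIM hg)]
    rw [idealOf, Submodule.mem_iInf] at hf
    have h1 := hf x
    rw [Submodule.mem_iInf] at h1
    have h2 : evalAt x f = 0 := h1 hxI
    rw [hx] at h2
    have h3 : ι (Ideal.Quotient.mk M f) = 0 := h2
    rw [map_eq_zero] at h3
    exact Ideal.Quotient.eq_zero_iff_mem.1 h3
  exact h

end Nullstellensatz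

/-! ### Graded pieces of ideals and a finiteness criterion. -/

section GradedPieces

variable {m : ℕ}

/-- Exponents of degree `d`. -/
abbrev DegExp (m d : ℕ) : Type := {u : Fin m →₀ ℕ // u.degree = d}

instance fintypeDegExp (d : ℕ) : Fintype (DegExp m d) :=
  ((Finsupp.finite_of_degree_le (σ := Fin m) d).subset fun _ h => le_of_eq h).fintype

variable (F : Type*) [Field F]

/-- The coefficients in degree `d`. -/
def degCoeffs (d : ℕ) : MvPolynomial (Fin m) F →ₗ[F] (DegExp m d → F) :=
  LinearMap.pi fun u => MvPolynomial.lcoeff F u.1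

/-- The form of degree `d` with given coefficients. -/
def degForm (d : ℕ) : (DegExp m d → F) →ₗ[F] MvPolynomial (Fin m) F :=
  ∑ u : DegExp m d, (MvPolynomial.monomial u.1).comp (LinearMap.proj u)

variable {F}

@[simp]
theorem degCoeffs_apply {d : ℕ} (f : MvPolynomial (Fin m) F) (u : DegExp m d) :
    degCoeffs F d f u = f.coeff u.1 := rfl

theorem degForm_apply {d : ℕ} (x : DegExp m d → F) :
    degForm F d x = ∑ u : DegExp m d, MvPolynomial.monomial u.1 (x u) := by
  simp [degForm]

theorem coeff_degForm {d : ℕ} (x : DegExp m d → F) (u : DegExp m d) :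
    (degForm F d x).coeff u.1 = x u := by
  classical
  rw [degForm_apply, MvPolynomial.coeff_sum]
  simp [MvPolynomial.coeff_monomial, Subtype.coe_inj]

theorem coeff_degForm_of_ne {d : ℕ} (x : DegExp m d → F) {u : Fin m →₀ ℕ} (hu : u.degree ≠ d) :
    (degForm F d x).coeff u = 0 := by
  classical
  rw [degForm_apply, MvPolynomial.coeff_sum]
  refine Finset.sum_eq_zero fun u' _ => ?_
  rw [MvPolynomial.coeff_monomial, if_neg]
  rintro rfl
  exact hu u'.2

theorem degForm_degCoeffs (d : ℕ) (f : MvPolynomial (Fin m) F) :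
    degForm F d (degCoeffs F d f) = MvPolynomial.homogeneousComponent d f := by
  classical
  ext u
  rw [MvPolynomial.coeff_homogeneousComponent]
  split_ifs with h
  · exact coeff_degForm _ ⟨u, h⟩
  · exact coeff_degForm_of_ne _ h

theorem degForm_single [DecidableEq (Fin m →₀ ℕ)] {d : ℕ} (u : DegExp m d) :
    degForm F d (Pi.single u 1) = MvPolynomial.monomial u.1 1 := by
  classical
  rw [degForm_apply, Finset.sum_eq_single u]
  · rw [Pi.single_eq_same]
  · intro u' _ hne
    rw [Pi.single_eq_of_ne hne, map_zero]
  · exact fun h => absurd (Finset.mem_univ u) h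

/-- The part of degree `d` of an ideal. -/
def degPart (d : ℕ) (H : Ideal (MvPolynomial (Fin m) F)) : Submodule F (DegExp m d → F) :=
  (H.restrictScalars F).comap (degForm F d)

theorem mem_degPart {d : ℕ} {H : Ideal (MvPolynomial (Fin m) F)} {x : DegExp m d → F} :
    x ∈ degPart d H ↔ degForm F d x ∈ H := Iff.rfl

theorem mem_of_forall_degCoeffs_mem {H : Ideal (MvPolynomial (Fin m) F)}
    {f : MvPolynomial (Fin m) F} (h : ∀ d, degCoeffs F d f ∈ degPart d H) : f ∈ H := by
  rw [← MvPolynomial.sum_homogeneousComponent f]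
  refine H.sum_mem fun d _ => ?_
  rw [← degForm_degCoeffs]
  exact h d

open Module in
/-- A set of homogeneous ideals with the same Hilbert function, each graded part of which takes
only finitely many values, is finite. -/
theorem finite_of_degPart {S : Set (Ideal (MvPolynomial (Fin m) F))}
    (hhom : ∀ H ∈ S, ∀ f ∈ H, ∀ d, degCoeffs F d f ∈ degPart d H)
    (hfin : ∀ d, (degPart d '' S).Finite)
    (hrank : ∀ d, ∀ H ∈ S, ∀ H' ∈ S, finrank F (degPart d H) = finrank F (degPart d H')) :
    S.Finite := by
  by_contra hinf
  have : Infinite S := Set.infinite_coe_iff.2 hinf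
  -- Along a nonprincipal ultrafilter the ideals have a limit `T`, consisting of the polynomials
  -- that lie in almost all of them.
  let U : Ultrafilter S := Filter.hyperfilter S
  let T : Ideal (MvPolynomial (Fin m) F) :=
    { carrier := {f | ∀ᶠ H : S in (U : Filter S), f ∈ H.1}
      add_mem' := fun ha hb => by
        filter_upwards [ha, hb] with H h1 h2 using H.1.add_mem h1 h2
      zero_mem' := Filter.Eventually.of_forall fun H => H.1.zero_mem
      smul_mem' := fun c x hx => by
        filter_upwards [hx] with H h using H.1.mul_mem_left c h }
  have hT : ∀ f, f ∈ T ↔ ∀ᶠ H : S in (U : Filter S), f ∈ H.1 := fun _ => Iff.rfl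
  have hP : ∀ d, ∃ P, ∀ᶠ H : S in (U : Filter S), P = degPart d H.1 := by
    intro d
    obtain ⟨P, -, hP⟩ := (Ultrafilter.eventually_exists_mem_iff (hfin d)).1
      (Filter.Eventually.of_forall (f := (U : Filter S)) fun H : S =>
        ⟨degPart d H.1, Set.mem_image_of_mem _ H.2, rfl⟩ :
        ∀ᶠ H : S in (U : Filter S), ∃ P ∈ degPart d '' S, P = degPart d H.1)
    exact ⟨P, hP⟩
  obtain ⟨s, hs⟩ := (inferInstance : IsNoetherianRing (MvPolynomial (Fin m) F)).noetherian T
  -- Finitely many generators of `T` lie simultaneously in almost every member.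
  have hle : ∀ᶠ H : S in (U : Filter S), T ≤ H.1 := by
    have h1 : ∀ᶠ H : S in (U : Filter S), ∀ f ∈ s, f ∈ H.1 := by
      rw [Filter.eventually_all_finset]
      intro f hf
      rw [← hT, ← hs]
      exact Submodule.subset_span hf
    filter_upwards [h1] with H h
    rw [← hs, Submodule.span_le]
    exact h
  -- In degree `d` the almost constant value `P` lies in `T`, hence in `H`, and the common Hilbert
  -- function forces equality. Almost every member is then `T`, impossible for a nonprincipal
  -- ultrafilter.
  have heq : ∀ᶠ H : S in (U : Filter S), H.1 = T := by
    filter_upwards [hle] with H hTH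
    refine le_antisymm (fun f hf => mem_of_forall_degCoeffs_mem fun d => ?_) hTH
    obtain ⟨P, hP⟩ := hP d
    have hPT : P ≤ degPart d T := by
      intro y hy
      rw [mem_degPart, hT]
      filter_upwards [hP] with H' h'
      rw [h'] at hy
      exact hy
    obtain ⟨H', hH'⟩ := hP.exists
    have hPH : P = degPart d H.1 := by
      apply Submodule.eq_of_le_of_finrank_eq
      · exact fun y hy => hTH (hPT hy)
      · rw [hH']
        exact hrank d _ H'.2 _ H.2
    exact hPT (hPH ▸ hhom _ H.2 f hf d)
  have hfinite : {H : S | H.1 = T}.Finite :=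
    Set.Subsingleton.finite fun a ha b hb => Subtype.ext (ha.trans hb.symm)
  exact Set.Finite.notMem_hyperfilter hfinite heq

end GradedPieces

/-! ### Initial ideals, degree by degree. -/

section InitialIdeal

variable {K : Type*} [Field K] {v : AddValuation K (WithTop ℝ)} (t : Splitting v) {m : ℕ}

theorem tropPoly_monomial_mul (w : Fin m → ℝ) (s : Fin m →₀ ℕ) (f : MvPolynomial (Fin m) K) :
    tropPoly v (MvPolynomial.monomial s 1 * f) w
      = tropPoly v f w + ((∑ i, w i * (s i : ℝ) : ℝ) : WithTop ℝ) := by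
  have hwt : ∀ u : Fin m →₀ ℕ, ((∑ i, w i * ((s + u) i : ℝ) : ℝ) : WithTop ℝ) =
      ((∑ i, w i * (u i : ℝ) : ℝ) : WithTop ℝ) + ((∑ i, w i * (s i : ℝ) : ℝ) : WithTop ℝ) := by
    intro u
    rw [← WithTop.coe_add, ← Finset.sum_add_distrib]
    congr 1
    refine Finset.sum_congr rfl fun i _ => ?_
    simp
    ring
  by_cases hf : f = 0
  · simp [hf, tropPoly]
  apply le_antisymm
  · obtain ⟨u, -, hu⟩ := exists_eq_tropPoly (v := v) w hf
    have h := tropPoly_le (v := v) w (MvPolynomial.monomial s 1 * f) (s + u)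
    rwa [MvPolynomial.coeff_monomial_mul, one_mul, hwt, ← add_assoc, hu] at h
  · have hne : MvPolynomial.monomial s (1 : K) * f ≠ 0 :=
      mul_ne_zero (by simp) hf
    obtain ⟨u, hu0, hu⟩ := exists_eq_tropPoly (v := v) w hne
    have hsu : s ≤ u := by
      by_contra h
      rw [MvPolynomial.coeff_monomial_mul', if_neg h] at hu0
      exact hu0 rfl
    obtain ⟨u, rfl⟩ := exists_add_of_le hsu
    rw [← hu, MvPolynomial.coeff_monomial_mul, one_mul, hwt, ← add_assoc]
    exact add_le_add_left (tropPoly_le w f u) _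

/-- All weighted values shift by the same constant, so the minimizing terms correspond. Hence the
linear span of the initial forms of an ideal is already an ideal. -/
theorem initialForm_monomial_mul (w : Fin m → ℝ) (s : Fin m →₀ ℕ) (f : MvPolynomial (Fin m) K) :
    initialForm t w (MvPolynomial.monomial s 1 * f)
      = MvPolynomial.monomial s 1 * initialForm t w f := by
  classical
  ext u
  rw [coeff_initialForm]
  by_cases hsu : s ≤ u
  · obtain ⟨u, rfl⟩ := exists_add_of_le hsu
    have hwt : ((∑ i, w i * ((s + u) i : ℝ) : ℝ) : WithTop ℝ) =
        ((∑ i, w i * (u i : ℝ) : ℝ) : WithTop ℝ) + ((∑ i, w i * (s i : ℝ) : ℝ) : WithTop ℝ) := by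
      rw [← WithTop.coe_add, ← Finset.sum_add_distrib]
      congr 1
      refine Finset.sum_congr rfl fun i _ => ?_
      simp
      ring
    rw [MvPolynomial.coeff_monomial_mul, MvPolynomial.coeff_monomial_mul, one_mul, one_mul,
      coeff_initialForm, tropPoly_monomial_mul, hwt, ← add_assoc]
    simp only [WithTop.add_right_inj WithTop.coe_ne_top]
  · rw [MvPolynomial.coeff_monomial_mul', MvPolynomial.coeff_monomial_mul', if_neg hsu, if_neg hsu]
    simp

/-- The initial ideal is the linear span of the initial forms. -/
theorem initialIdeal_induction {w : Fin m → ℝ} {J : Ideal (MvPolynomial (Fin m) K)}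
    {P : Submodule (ResField v) (MvPolynomial (Fin m) (ResField v))}
    (hP : ∀ f ∈ J, initialForm t w f ∈ P) {h : MvPolynomial (Fin m) (ResField v)}
    (hh : h ∈ initialIdeal t w J) : h ∈ P := by
  have key : ∀ q : MvPolynomial (Fin m) (ResField v), ∀ f ∈ J, q * initialForm t w f ∈ P := by
    intro q f hf
    induction q using MvPolynomial.induction_on' with
    | monomial u a =>
      have h1 : MvPolynomial.monomial u a * initialForm t w f
          = a • initialForm t w (MvPolynomial.monomial u 1 * f) := by
        rw [initialForm_monomial_mul, ← smul_mul_assoc, MvPolynomial.smul_monomial, smul_eq_mul,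
          mul_one]
      rw [h1]
      exact P.smul_mem a (hP _ (J.mul_mem_left _ hf))
    | add p q hp hq =>
      rw [add_mul]
      exact P.add_mem hp hq
  rw [initialIdeal, ← Ideal.submodule_span_eq] at hh
  induction hh using Submodule.closure_induction with
  | zero => exact P.zero_mem
  | add x y _ _ hx hy => exact P.add_mem hx hy
  | smul_mem q x hx =>
    obtain ⟨f, hf, rfl⟩ := hx
    exact key q f hf

/-- The weights of the monomials of degree `d`. -/
def degWeight (w : Fin m → ℝ) (d : ℕ) : DegExp m d → ℝ := fun u => ∑ i, w i * (u.1 i : ℝ)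

/-- The coefficient vectors of the elements of `J` in degree `d`. -/
def degCoeffSpace (d : ℕ) (J : Ideal (MvPolynomial (Fin m) K)) : Submodule K (DegExp m d → K) :=
  (J.restrictScalars K).map (degCoeffs K d)

theorem tropPoly_homogeneousComponent (w : Fin m → ℝ) (d : ℕ) (f : MvPolynomial (Fin m) K) :
    tropPoly v (MvPolynomial.homogeneousComponent d f) w
      = vecTrop v (degWeight w d) (degCoeffs K d f) := by
  classical
  apply le_antisymm
  · refine Finset.le_inf fun u _ => ?_
    have h := tropPoly_le (v := v) w (MvPolynomial.homogeneousComponent d f) u.1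
    rwa [MvPolynomial.coeff_homogeneousComponent, if_pos u.2] at h
  · refine Finset.le_inf fun u hu => ?_
    rw [MvPolynomial.mem_support_iff, MvPolynomial.coeff_homogeneousComponent] at hu
    have hd : u.degree = d := by
      by_contra h
      exact hu (if_neg h)
    rw [MvPolynomial.coeff_homogeneousComponent, if_pos hd]
    exact vecTrop_le (v := v) (degWeight w d) (degCoeffs K d f) ⟨u, hd⟩

theorem initialForm_homogeneousComponent (w : Fin m → ℝ) (d : ℕ) (f : MvPolynomial (Fin m) K) :
    initialForm t w (MvPolynomial.homogeneousComponent d f)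
      = degForm (ResField v) d (vecInit t (degWeight w d) (degCoeffs K d f)) := by
  classical
  ext u
  rw [coeff_initialForm, tropPoly_homogeneousComponent, MvPolynomial.coeff_homogeneousComponent]
  by_cases h : u.degree = d
  · rw [if_pos h, coeff_degForm _ (⟨u, h⟩ : DegExp m d)]
    rfl
  · rw [if_neg h, coeff_degForm_of_ne _ h]
    simp

/-- If the minimum of `f` is reached in degree `d`, that part of the initial form is the initial
vector of the degree `d` coefficients; otherwise it vanishes. Neither case needs homogeneity. -/
theorem degCoeffs_initialForm_mem (w : Fin m → ℝ) (d : ℕ) {J : Ideal (MvPolynomial (Fin m) K)}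
    {f : MvPolynomial (Fin m) K} (hf : f ∈ J) :
    degCoeffs (ResField v) d (initialForm t w f)
      ∈ vecInitSpace t (degWeight w d) (degCoeffSpace d J) := by
  classical
  by_cases h : tropPoly v f w = vecTrop v (degWeight w d) (degCoeffs K d f)
  · have h1 : degCoeffs (ResField v) d (initialForm t w f)
        = vecInit t (degWeight w d) (degCoeffs K d f) := by
      funext u
      rw [degCoeffs_apply, coeff_initialForm, h]
      rfl
    rw [h1]
    exact vecInit_mem t ⟨f, hf, rfl⟩
  · have h1 : degCoeffs (ResField v) d (initialForm t w f) = 0 := by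
      funext u
      rw [degCoeffs_apply, coeff_initialForm, if_neg]
      · rfl
      · intro h2
        refine h (le_antisymm (Finset.le_inf fun u' _ => tropPoly_le w f u'.1) ?_)
        rw [← h2]
        exact vecTrop_le (v := v) (degWeight w d) (degCoeffs K d f) u
    rw [h1]
    exact zero_mem _

variable {J : Ideal (MvPolynomial (Fin m) K)}

theorem degCoeffs_mem_of_mem_initialIdeal (w : Fin m → ℝ) (d : ℕ)
    {h : MvPolynomial (Fin m) (ResField v)} (hh : h ∈ initialIdeal t w J) :
    degCoeffs (ResField v) d h ∈ vecInitSpace t (degWeight w d) (degCoeffSpace d J) :=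
  initialIdeal_induction t (P := (vecInitSpace t (degWeight w d) (degCoeffSpace d J)).comap
    (degCoeffs (ResField v) d)) (fun _ hf => degCoeffs_initialForm_mem t w d hf) hh

/-- This bridge to linear algebra uses homogeneity of `J` for the inclusion from right to left,
where each initial vector must be the initial form of an element of `J`. -/
theorem degPart_initialIdeal (hJ : ∀ f ∈ J, ∀ d, MvPolynomial.homogeneousComponent d f ∈ J)
    (w : Fin m → ℝ) (d : ℕ) :
    degPart d (initialIdeal t w J) = vecInitSpace t (degWeight w d) (degCoeffSpace d J) := by
  apply le_antisymm
  · intro x hx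
    have h := degCoeffs_mem_of_mem_initialIdeal t w d (mem_degPart.1 hx)
    have h1 : degCoeffs (ResField v) d (degForm (ResField v) d x) = x :=
      funext fun u => coeff_degForm x u
    rwa [h1] at h
  · rw [vecInitSpace, Submodule.span_le]
    rintro _ ⟨_, ⟨f, hf, rfl⟩, rfl⟩
    rw [SetLike.mem_coe, mem_degPart, ← initialForm_homogeneousComponent]
    exact Ideal.subset_span ⟨_, hJ f hf d, rfl⟩

/-- A homogeneous ideal has only finitely many initial ideals. -/
theorem finite_range_initialIdeal (hJ : ∀ f ∈ J, ∀ d, MvPolynomial.homogeneousComponent d f ∈ J) :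
    (Set.range fun w => initialIdeal t w J).Finite := by
  apply finite_of_degPart
  · rintro _ ⟨w, rfl⟩ f hf d
    rw [degPart_initialIdeal t hJ]
    exact degCoeffs_mem_of_mem_initialIdeal t w d hf
  · intro d
    refine (finite_range_vecInitSpace t (degCoeffSpace d J)).subset ?_
    rintro _ ⟨_, ⟨w, rfl⟩, rfl⟩
    exact ⟨degWeight w d, (degPart_initialIdeal t hJ w d).symm⟩
  · rintro d _ ⟨w, rfl⟩ _ ⟨w', rfl⟩
    rw [degPart_initialIdeal t hJ, degPart_initialIdeal t hJ, finrank_vecInitSpace,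
      finrank_vecInitSpace]

/-- Cells are the nonempty fibres of the map from weights to initial ideals. -/
theorem finite_cells (hJ : ∀ f ∈ J, ∀ d, MvPolynomial.homogeneousComponent d f ∈ J) :
    (cells t J).Finite := by
  refine ((finite_range_initialIdeal t hJ).image
    fun H => {w' : Fin m → ℝ | initialIdeal t w' J = H}).subset ?_
  rintro _ ⟨w, rfl⟩
  exact ⟨_, ⟨w, rfl⟩, rfl⟩

/-- A monomial in an initial ideal is the initial form of one and the same element on the cell. -/
theorem exists_initialForm_eq_monomial (hJ : ∀ f ∈ J, ∀ d, MvPolynomial.homogeneousComponent d f ∈ J)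
    (w : Fin m → ℝ) (u : Fin m →₀ ℕ)
    (hu : MvPolynomial.monomial u 1 ∈ initialIdeal t w J) :
    ∃ g ∈ J, ∀ w' ∈ cell t J w, initialForm t w' g = MvPolynomial.monomial u 1 := by
  classical
  have h1 : Pi.single (⟨u, rfl⟩ : DegExp m u.degree) 1
      ∈ vecInitSpace t (degWeight w u.degree) (degCoeffSpace u.degree J) := by
    rw [← degPart_initialIdeal t hJ, mem_degPart, degForm_single]
    exact hu
  obtain ⟨_, ⟨f, hf, rfl⟩, h2⟩ := exists_vecInit_eq_single t _ _ _ h1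
  refine ⟨_, hJ f hf u.degree, fun w' hw' => ?_⟩
  rw [initialForm_homogeneousComponent, h2, degForm_single]
  have hw' : initialIdeal t w' J = initialIdeal t w J := hw'
  rw [← degPart_initialIdeal t hJ, ← degPart_initialIdeal t hJ, hw']

end InitialIdeal

/-! ### From the Gröbner complex to a tropical basis. -/

section TropicalBasis

variable {K : Type*} [Field K] {v : AddValuation K (WithTop ℝ)} {n : ℕ}

theorem homogenize_isHomogeneous (f : MvPolynomial (Fin n) K) :
    (homogenize f).IsHomogeneous f.totalDegree := by
  rw [homogenize]
  refine MvPolynomial.IsHomogeneous.sum _ _ _ fun u hu => ?_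
  refine MvPolynomial.isHomogeneous_monomial _ ?_
  -- This makes the truncated subtraction in the exponent of `x_0` exact.
  have h : u.degree ≤ f.totalDegree := MvPolynomial.le_totalDegree hu
  rw [Finsupp.degree_eq_sum, Fin.sum_univ_succ]
  rw [Finsupp.degree_eq_sum] at h ⊢
  simp only [Finsupp.cons_zero, Finsupp.cons_succ]
  omega

attribute [local instance] MvPolynomial.gradedAlgebra in
theorem homogeneousComponent_mem_homogIdeal (I : Ideal (Laurent n K)) :
    ∀ f ∈ homogIdeal I, ∀ d, MvPolynomial.homogeneousComponent d f ∈ homogIdeal I := by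
  intro f hf d
  refine MvPolynomial.homogeneousComponent_mem_of_mem ?_ hf d
  refine Ideal.homogeneous_span _ _ ?_
  rintro _ ⟨p, -, rfl⟩
  exact ⟨_, homogenize_isHomogeneous p⟩

theorem StrictMin.of_toLaurent {p : MvPolynomial (Fin n) K} {w : Fin n → ℝ} {a : Fin n → ℤ}
    (h : StrictMin v (fun u => (toLaurent p).coeff u) (fun u => ∑ i, w i * (u i : ℝ)) a) :
    ∃ b, StrictMin v (fun u => p.coeff u) (fun u => ∑ i, w i * (u i : ℝ)) b := by
  rw [coeff_toLaurent] at h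
  obtain ⟨b, hb⟩ := StrictMin.of_mapDomain castExp_injective h
  refine ⟨b, ?_⟩
  simp only [castExp, AddMonoidHom.coe_mk, ZeroHom.coe_mk, Int.cast_natCast] at hb
  exact hb

theorem StrictMin.homogenize {p : MvPolynomial (Fin n) K} {w : Fin n → ℝ} {a : Fin n →₀ ℕ}
    (h : StrictMin v (fun u => p.coeff u) (fun u => ∑ i, w i * (u i : ℝ)) a) :
    ∃ b, StrictMin v (fun u => (homogenize p).coeff u)
      (fun u => ∑ i, (Fin.cons 0 w : Fin (n + 1) → ℝ) i * (u i : ℝ)) b := by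
  have h1 := StrictMin.mapDomain (c := AddMonoidAlgebra.coeff p) h
    (fun u => Finsupp.cons (p.totalDegree - u.degree) u)
    (ψ := fun u => ∑ i, (Fin.cons 0 w : Fin (n + 1) → ℝ) i * (u i : ℝ))
    (fun u => by simp [Fin.sum_univ_succ])
  rw [← coeff_homogenize] at h1
  exact ⟨_, h1⟩

/-- Monomials may merge when `x_0 = 1`, but `x_0` has weight `0`, so merging monomials have equal
weight and the unique minimal term cannot cancel. -/
theorem StrictMin.dehomogenize {F : MvPolynomial (Fin (n + 1)) K} {w : Fin n → ℝ}
    {a : Fin (n + 1) →₀ ℕ}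
    (h : StrictMin v (fun u => F.coeff u)
      (fun u => ∑ i, (Fin.cons 0 w : Fin (n + 1) → ℝ) i * (u i : ℝ)) a) :
    ∃ b, StrictMin v (fun u => (dehomogenize F).coeff u) (fun u => ∑ i, w i * (u i : ℝ)) b := by
  have h1 := StrictMin.mapDomain (c := AddMonoidAlgebra.coeff F) h tailExp
    (ψ := fun u => ∑ i, w i * (u i : ℝ))
    (fun u => by simp [Fin.sum_univ_succ, tailExp])
  rw [← coeff_dehomogenize] at h1
  exact ⟨_, h1⟩

/-- Away from the tropical variety of `I`, an initial ideal of `I^h` contains a monomial. -/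
theorem exists_monomial_mem_of_notMem_tropVariety (t : Splitting v) {I : Ideal (Laurent n K)}
    {w : Fin n → ℝ} (hw : w ∉ tropVariety v (zeroSet I)) :
    ∃ u, MvPolynomial.monomial u 1 ∈ initialIdeal t (Fin.cons 0 w) (homogIdeal I) := by
  simp only [tropVariety, Set.mem_iInter, not_forall] at hw
  obtain ⟨f, hf, hwf⟩ := hw
  obtain ⟨a, ha⟩ := (notMem_tropHypersurface_iff f w).1 hwf
  obtain ⟨k, hk⟩ := exists_pow_mem_of_mem_idealOf hf
  obtain ⟨b, p, hp⟩ := exists_monomial_mul_eq_toLaurent (f ^ k)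
  have hpI : toLaurent p ∈ I := hp ▸ I.mul_mem_left _ hk
  have h1 : StrictMin v (fun u => (toLaurent (MvPolynomial.monomial b (1 : K))).coeff u)
      (weightHom w) (castExp b) := by
    rw [toLaurent_eq, ← MvPolynomial.single_eq_monomial, AddMonoidAlgebra.mapDomainAlgHom_apply,
      AddMonoidAlgebra.mapDomain_single]
    exact strictMin_single _ _ one_ne_zero
  have h2 := h1.mul (StrictMin.pow (φ := weightHom w) ha k)
  rw [hp] at h2
  obtain ⟨c, hc⟩ := StrictMin.of_toLaurent (w := w) h2
  obtain ⟨u, hu⟩ := hc.homogenize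
  refine ⟨u, ?_⟩
  have h3 : initialForm t (Fin.cons 0 w) (homogenize p)
      ∈ initialIdeal t (Fin.cons 0 w) (homogIdeal I) :=
    Ideal.subset_span ⟨_, Ideal.subset_span ⟨p, hpI, rfl⟩, rfl⟩
  rw [hu.initialForm_eq t] at h3
  -- The initial form is a monomial up to a nonzero leading residue, which is divided out.
  have h4 := Ideal.mul_mem_left _
    (MvPolynomial.C (t.leadRes ((homogenize p).coeff u))⁻¹) h3
  rwa [MvPolynomial.C_mul_monomial, inv_mul_cancel₀ (leadRes_ne_zero t hu.1)] at h4

theorem le_idealOf_zeroSet (I : Ideal (Laurent n K)) : I ≤ idealOf (zeroSet I) := by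
  rw [idealOf]
  exact le_iInf₂ fun x hx f hf => hx f hf

/-- A finite generating set together with witnesses for all cells whose initial ideal contains a
monomial is a finite tropical basis. -/
theorem isFiniteTropicalBasis_union (t : Splitting v) (I : Ideal (Laurent n K))
    (F : Set (Laurent n K)) (g : Set (Fin (n + 1) → ℝ) → MvPolynomial (Fin (n + 1)) K)
    (hfin : F.Finite) (hspan : Ideal.span F = I)
    (hg : ∀ σ ∈ monomialCells t (homogIdeal I), g σ ∈ homogIdeal I ∧
      ∃ u : Fin (n + 1) →₀ ℕ, ∀ w' ∈ σ,
        initialForm t w' (g σ) = MvPolynomial.monomial u 1) :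
    IsFiniteTropicalBasis v I
      (F ∪ (fun σ => dehomogenize (g σ)) '' monomialCells t (homogIdeal I)) := by
  have hsub : F ∪ (fun σ => dehomogenize (g σ)) '' monomialCells t (homogIdeal I)
      ⊆ (I : Set (Laurent n K)) := by
    apply Set.union_subset
    · rw [← hspan]
      exact Ideal.subset_span
    · rintro _ ⟨σ, hσ, rfl⟩
      exact dehomogenize_mem (hg σ hσ).1
  refine ⟨?_, hsub, ?_, ?_⟩
  · refine hfin.union (Set.Finite.image _ ?_)
    refine (finite_cells t (homogeneousComponent_mem_homogIdeal I)).subset ?_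
    rintro _ ⟨w, rfl, -⟩
    exact ⟨w, rfl⟩
  · apply le_antisymm
    · exact Set.subset_iInter₂ fun f hf =>
        Set.iInter₂_subset f (le_idealOf_zeroSet I (hsub hf))
    · intro w hw
      by_contra hwV
      obtain ⟨u, hu⟩ := exists_monomial_mem_of_notMem_tropVariety t hwV
      have hσ : cell t (homogIdeal I) (Fin.cons 0 w) ∈ monomialCells t (homogIdeal I) :=
        ⟨_, rfl, u, hu⟩
      obtain ⟨-, u', hu'⟩ := hg _ hσ
      -- The weight lies in its own cell, so the witness has a unique minimum there; its
      -- dehomogenization keeps `w` out of the intersection.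
      have hmem : (Fin.cons 0 w : Fin (n + 1) → ℝ) ∈ cell t (homogIdeal I) (Fin.cons 0 w) := rfl
      have h1 := (strictMin_of_initialForm_eq t (hu' _ hmem)).dehomogenize
      refine (notMem_tropHypersurface_iff _ w).2 h1 ?_
      exact Set.mem_iInter₂.1 hw _ (Or.inr ⟨_, hσ, rfl⟩)
  · apply le_antisymm
    · exact Ideal.span_le.2 hsub
    · calc I = Ideal.span F := hspan.symm
        _ ≤ _ := Ideal.span_mono Set.subset_union_left

theorem exists_isFiniteTropicalBasis (t : Splitting v) (I : Ideal (Laurent n K)) :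
    ∃ B, IsFiniteTropicalBasis v I B := by
  have h : ∀ σ ∈ monomialCells t (homogIdeal I), ∃ g ∈ homogIdeal I,
      ∃ u : Fin (n + 1) →₀ ℕ, ∀ w' ∈ σ, initialForm t w' g = MvPolynomial.monomial u 1 := by
    rintro _ ⟨w, rfl, u, hu⟩
    obtain ⟨g, hg, hg'⟩ :=
      exists_initialForm_eq_monomial t (homogeneousComponent_mem_homogIdeal I) w u hu
    exact ⟨g, hg, u, hg'⟩
  choose! g hg using h
  obtain ⟨s, hs⟩ := isNoetherianRing_laurent.noetherian I
  exact ⟨_, isFiniteTropicalBasis_union t I s g s.finite_toSet hs hg⟩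

end TropicalBasis

end TropBasis

end

/-- Every ideal of the Laurent polynomial ring has a finite tropical basis; and the Gröbner complex
of `I^h` has finitely many cells, for each monomial in the initial ideal of a cell there is an
element of `I^h` whose initial form is that monomial on the whole cell, and adding one such element
for each cell whose initial ideal contains a monomial to any finite generating set of `I` gives a
finite tropical basis. -/
theorem theoremt {K : Type*} [Field K] (v : AddValuation K (WithTop ℝ))
    (t : TropBasis.Splitting v) (n : ℕ) (I : Ideal (TropBasis.Laurent n K)) :
    (∃ B : Set (TropBasis.Laurent n K), TropBasis.IsFiniteTropicalBasis v I B) ∧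
    (TropBasis.cells t (TropBasis.homogIdeal I)).Finite ∧
    (∀ (w : Fin (n + 1) → ℝ) (u : Fin (n + 1) →₀ ℕ),
      MvPolynomial.monomial u 1 ∈ TropBasis.initialIdeal t w (TropBasis.homogIdeal I) →
      ∃ g ∈ TropBasis.homogIdeal I, ∀ w' ∈ TropBasis.cell t (TropBasis.homogIdeal I) w,
        TropBasis.initialForm t w' g = MvPolynomial.monomial u 1) ∧
    (∀ (F : Set (TropBasis.Laurent n K))
      (g : Set (Fin (n + 1) → ℝ) → MvPolynomial (Fin (n + 1)) K),
      F.Finite → Ideal.span F = I →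
      (∀ σ ∈ TropBasis.monomialCells t (TropBasis.homogIdeal I),
        g σ ∈ TropBasis.homogIdeal I ∧
        ∃ u : Fin (n + 1) →₀ ℕ, ∀ w' ∈ σ,
          TropBasis.initialForm t w' (g σ) = MvPolynomial.monomial u 1) →
      TropBasis.IsFiniteTropicalBasis v I
        (F ∪ (fun σ => TropBasis.dehomogenize (g σ)) ''
          TropBasis.monomialCells t (TropBasis.homogIdeal I))) := by
  exact ⟨TropBasis.exists_isFiniteTropicalBasis t I,
    TropBasis.finite_cells t (TropBasis.homogeneousComponent_mem_homogIdeal I),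
    TropBasis.exists_initialForm_eq_monomial t (TropBasis.homogeneousComponent_mem_homogIdeal I),
    TropBasis.isFiniteTropicalBasis_union t I⟩
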